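/- Let $k$ be a field, and let $H$ be a Hopf algebra over $k$ with bijective antipode $S$. Let $\mathcal P$ be a locally trivial quantum principal fibre bundle with structure Hopf algebra $H$: a right $H$-comodule algebra $\mathcal P$ with an injective homomorphism $\iota:B\to\mathcal P$, a finite complete covering of $B$ by ideals $J_i$ (i.e. $\bigcap_iJ_i=0$ and $B$ is the gluing of the quotients $\pi_i:B\to B_i=B/J_i$ over the $B/(J_i+J_j)$), and surjective $H$-colinear homomorphisms $\chi_i:\mathcal P\to B_i\otimes H$ with $\chi_i(\iota(b))=\pi_i(b)\otimes 1$ whose kernels form a complete covering of $\mathcal P$. Let a differential structure on $\mathcal P$ be given: differential algebras $\Gamma(B_i)$, a right covariant differential algebra $\Gamma(H)$, and the differential algebra $\Gamma(\mathcal P)$ over $\mathcal P$ to which all $\chi_i$ extend as homomorphisms $\chi_{i,\Gamma}:\Gamma(\mathcal P)\to\Gamma(B_i)\hat\otimes\Gamma(H)$ of differential algebras with $\bigcap_i\ker\chi_{i,\Gamma}=0$. Let $\Gamma_c(\mathcal P)$ be its covering completion with respect to the ideals $\ker\chi_{i,\Gamma}$, and let $\mathrm{hor}\,\Gamma_c(\mathcal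 P)$ be the set of $\gamma\in\Gamma_c(\mathcal P)$ all of whose components lie in $\Gamma(B_i)\otimes H$. Suppose that the calculus on $H$ is bicovariant, i.e. that the right ideal $R=\{r\in\ker\varepsilon:\sum S^{-1}(r_2)\,dr_1=0\}$ is $\mathrm{Ad}$-invariant: $\sum r_2\otimes S(r_1)r_3\in R\otimes H$ for all $r\in R$. A left (right) connection is a left (right) $\mathcal P$-linear, $H$-colinear projection $\mathrm{hor}$ of $\Gamma^1_c(\mathcal P)$ onto $\mathrm{hor}\,\Gamma_c^1(\mathcal P)$ that maps the kernel of each component map $\chi_i$ into itself. Its covariant derivative $D=\mathrm{hor}\circ d$ on $\mathrm{hor}\,\Gamma_c(\mathcal P)$ is given in the $i$-th component by $D(\gamma\otimes h)=d\gamma\otimes h+(-1)^n(\gamma\otimes1)\,\mathrm{hor}(d(1\otimes h))$ for $\gamma\in\Gamma^n(B_i)$ in the left case and by $D(\gamma\otimes h)=d\gamma\otimes h+\mathrm{hor}(d(1\otimes h))\,(\gamma\otimes1)$ in the right case. Its local connection maps are $A_i:H\to\Gamma^1(B_i)$, $A_i(h)=-(\mathrm{id}\otimes\varepsilon)(\mathrm{hor}(d(1\otimes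 h)))$. A left (right) gauge transformation is a left (right) $\iota(B)$-module automorphism $\alpha$ of $\mathcal P$ such that $\chi_i\circ\alpha=\alpha_i\circ\chi_i$ for left (right) $B_i$-linear, $H$-colinear automorphisms $\alpha_i$ of $B_i\otimes H$ with $\alpha_i(b\otimes1)=b\otimes 1$. Put $\tau_i(h)=(\mathrm{id}\otimes\varepsilon)(\alpha_i(1\otimes h))$, and let $\tau_i^{-1}$ be the corresponding map of $\alpha^{-1}$. On horizontal forms $\alpha$ acts in the $i$-th component by $\gamma\otimes h\mapsto\sum\gamma\,\tau_i(h_1)\otimes h_2$ in the left case and by $\gamma\otimes h\mapsto\sum\tau_i(h_1)\gamma\otimes h_2$ in the right case. Let $\mathcal Q$ be the subgroup of the left (right) gauge transformations $\alpha$ that are differentiable algebra isomorphisms, i.e. $\alpha$ is an algebra automorphism that extends to an automorphism of the differential algebra $\Gamma(\mathcal P)$, and each $\alpha_i$ extends to an automorphism of the differential algebra $\Gamma(B_i)\hat\otimes\Gamma(H)$. Then all left (right) connections are $\mathcal Q$-covariant: for every left (right) connection with covariant derivative $D$ and every $\alpha\in\mathcal Q$, the map $D'=\alpha\circ D\circ\alpha^{-1}$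 on $\mathrm{hor}\,\Gamma_c(\mathcal P)$ is again the covariant derivative of a left (right) connection. In both cases the local connection maps $A_i'$ of the latter are $$A_i'(h)=\sum A_i(h_2)\,\tau_i(S(h_1)h_3)+\sum\tau_i^{-1}(h_1)\,d\tau_i(h_2),\qquad h\in H .$$ -/

import Mathlib

open scoped TensorProduct

noncomputable section

namespace QPFB

universe u v w w₁ w₂ w₃ vH vB vP vI vL

/-! ### Coverings -/

section Covering

variable {k : Type u} [Field k] {A : Type v} [Ring A] [Algebra k A]
  {I : Type vI} {Q : I → Type w} [∀ i, Ring (Q i)] [∀ i, Algebra k (Q i)]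

/-- For a family of homomorphisms `f i : A → Q i` (thought of as quotient maps by the ideals
`ker (f i)`) and a linear subspace `V` of `A`, the families `(a i)` any two members of which have
a common representative in `V`. For surjective `f i` and `V = A` this says that `a i` and `a j`
coincide in `A / (ker (f i) + ker (f j))`, see `mem_glued_top_iff`. -/
def glued (f : ∀ i, A →ₐ[k] Q i) (V : Submodule k A) : Submodule k (∀ i, Q i) where
  carrier := {a | ∀ i j, ∃ x ∈ V, f i x = a i ∧ f j x = a j}
  zero_mem' := fun _ _ => ⟨0, V.zero_mem, by simp⟩
  add_mem' := by
    intro a b ha hb i j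
    obtain ⟨x, hx, h1, h2⟩ := ha i j
    obtain ⟨y, hy, h3, h4⟩ := hb i j
    exact ⟨x + y, V.add_mem hx hy, by simp [h1, h3], by simp [h2, h4]⟩
  smul_mem' := by
    intro c a ha i j
    obtain ⟨x, hx, h1, h2⟩ := ha i j
    exact ⟨c • x, V.smul_mem c hx, by simp [h1], by simp [h2]⟩

theorem mem_glued_top_iff (f : ∀ i, A →ₐ[k] Q i) (x : I → A) :
    (fun i => f i (x i)) ∈ glued f ⊤ ↔
      ∀ i j, x i - x j ∈ RingHom.ker (f i) ⊔ RingHom.ker (f j) := by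
  refine forall_congr' fun i => forall_congr' fun j => ?_
  rw [Submodule.mem_sup]
  constructor
  · rintro ⟨y, -, h1, h2⟩
    refine ⟨x i - y, ?_, y - x j, ?_, by abel⟩
    · rw [RingHom.mem_ker, map_sub, h1, sub_self]
    · rw [RingHom.mem_ker, map_sub, h2, sub_self]
  · rintro ⟨y, hy, z, hz, h⟩
    rw [RingHom.mem_ker] at hy hz
    refine ⟨x i - y, trivial, by rw [map_sub, hy, sub_zero], ?_⟩
    have : x i - y = x j + z := by
      rw [sub_eq_iff_eq_add, add_assoc, add_comm z y, h]; abel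
    rw [this, map_add, hz, add_zero]

/-- The ideals `ker (f i)`, with quotients `Q i`, form a complete covering of `A`: they intersect
in zero, and every compatible family in the quotients comes from an element of `A`. -/
structure IsCompleteCovering (f : ∀ i, A →ₐ[k] Q i) : Prop where
  surjective : ∀ i, Function.Surjective (f i)
  iInf_ker : ∀ x, (∀ i, f i x = 0) → x = 0
  complete : ∀ a ∈ glued f ⊤, ∃ x, ∀ i, f i x = a i

end Covering

/-! ### Differential algebras -/

/-- A differential algebra over `A`: a graded algebra with degree zero part `A`, generated by `A`
and `dA`, with a differential of degree one satisfying the graded Leibniz rule. -/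
structure DiffAlg (k : Type u) (A : Type v) [Field k] [Ring A] [Algebra k A] where
  Form : Type w
  [ring : Ring Form]
  [algebra : Algebra k Form]
  deg : ℕ → Submodule k Form
  [graded : GradedAlgebra deg]
  incl : A →ₐ[k] Form
  incl_injective : Function.Injective incl
  range_incl : LinearMap.range incl.toLinearMap = deg 0
  d : Form →ₗ[k] Form
  d_mem : ∀ n, ∀ x ∈ deg n, d x ∈ deg (n + 1)
  d_d : ∀ x, d (d x) = 0
  leibniz : ∀ n, ∀ x ∈ deg n, ∀ y, d (x * y) = d x * y + (-1) ^ n * (x * d y)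
  generated : Algebra.adjoin k (Set.range incl ∪ Set.range fun a => d (incl a)) = ⊤

attribute [instance] DiffAlg.ring DiffAlg.algebra DiffAlg.graded

namespace DiffAlg

variable {k : Type u} [Field k] {A : Type v} [Ring A] [Algebra k A]
  {A' : Type vH} [Ring A'] [Algebra k A']

/-- The degree involution `γ ↦ (-1)ⁿ γ` for `γ` of degree `n`. -/
def sgn (Γ : DiffAlg.{u, v, w} k A) : Γ.Form →ₗ[k] Γ.Form :=
  DirectSum.toModule k ℕ Γ.Form (fun n => ((-1 : k) ^ n) • (Γ.deg n).subtype) ∘ₗ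
    (DirectSum.decomposeLinearEquiv Γ.deg).toLinearMap

/-- The algebra `Γ ⊗̂ Θ`, the graded (skew) tensor product. -/
abbrev Tensor (Γ : DiffAlg.{u, v, w₁} k A) (Θ : DiffAlg.{u, vH, w₂} k A') :=
  GradedTensorProduct k Γ.deg Θ.deg

/-- The differential `d (γ ⊗ θ) = dγ ⊗ θ + (-1)ⁿ γ ⊗ dθ` of `Γ ⊗̂ Θ`. -/
def tensorD (Γ : DiffAlg.{u, v, w₁} k A) (Θ : DiffAlg.{u, vH, w₂} k A') :
    Γ.Tensor Θ →ₗ[k] Γ.Tensor Θ :=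
  (GradedTensorProduct.of k Γ.deg Θ.deg).toLinearMap ∘ₗ
    (TensorProduct.map Γ.d LinearMap.id + TensorProduct.map Γ.sgn Θ.d) ∘ₗ
    (GradedTensorProduct.of k Γ.deg Θ.deg).symm.toLinearMap

/-- The inclusion of the forms `Γ ⊗ A'` of degree zero in the second factor into `Γ ⊗̂ Θ`. -/
def horIncl (Γ : DiffAlg.{u, v, w₁} k A) (Θ : DiffAlg.{u, vH, w₂} k A') :
    Γ.Form ⊗[k] A' →ₗ[k] Γ.Tensor Θ :=
  (GradedTensorProduct.of k Γ.deg Θ.deg).toLinearMap ∘ₗ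
    TensorProduct.map LinearMap.id Θ.incl.toLinearMap

/-- The inclusion of `A ⊗ A'` as degree zero part of `Γ ⊗ A'`. -/
def baseIncl (Γ : DiffAlg.{u, v, w₁} k A) : A ⊗[k] A' →ₐ[k] Γ.Form ⊗[k] A' :=
  Algebra.TensorProduct.map Γ.incl (AlgHom.id k A')

/-- The inclusion of `A ⊗ A'` as degree zero part of `Γ ⊗̂ Θ`. -/
def tensorIncl (Γ : DiffAlg.{u, v, w₁} k A) (Θ : DiffAlg.{u, vH, w₂} k A') :
    A ⊗[k] A' →ₗ[k] Γ.Tensor Θ :=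
  Γ.horIncl Θ ∘ₗ Γ.baseIncl.toLinearMap

end DiffAlg

/-- A bijection `α` of `A` is a differentiable isomorphism with respect to the differential
algebra `(F, d)` with degree zero part `j : A → F`: it extends to an automorphism of the algebra
`F` that commutes with `d`. -/
def IsDifferentiableIso {k : Type u} [Field k] {A : Type v} [AddCommGroup A] [Module k A]
    {F : Type w} [Ring F] [Algebra k F] (j : A →ₗ[k] F) (d : F →ₗ[k] F) (α : A ≃ₗ[k] A) : Prop :=
  ∃ Φ : F ≃ₐ[k] F, (∀ a, Φ (j a) = j (α a)) ∧ ∀ x, Φ (d x) = d (Φ x)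

/-! ### Hopf algebra notions -/

section Hopf

variable {k : Type u} [Field k] {H : Type vH} [Ring H] [HopfAlgebra k H]

/-- The adjoint coaction `h ↦ ∑ h₂ ⊗ S(h₁) h₃`. -/
def ad : H →ₗ[k] H ⊗[k] H :=
  (LinearMap.mul' k H).lTensor H ∘ₗ
    (TensorProduct.leftComm k H H H).toLinearMap ∘ₗ
    TensorProduct.map (HopfAlgebra.antipode k) LinearMap.id ∘ₗ
    (Coalgebra.comul (R := k) (A := H)).lTensor H ∘ₗ Coalgebra.comul

/-- The coaction `m ⊗ h ↦ ∑ m ⊗ h₁ ⊗ h₂` on `M ⊗ H`. -/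
def freeCoact (M : Type v) [AddCommGroup M] [Module k M] :
    M ⊗[k] H →ₗ[k] (M ⊗[k] H) ⊗[k] H :=
  (TensorProduct.assoc k M H H).symm.toLinearMap ∘ₗ
    (Coalgebra.comul (R := k) (A := H)).lTensor M

/-- The map `id ⊗ ε`. -/
def idEps (M : Type v) [AddCommGroup M] [Module k M] : M ⊗[k] H →ₗ[k] M :=
  (TensorProduct.rid k M).toLinearMap ∘ₗ (Coalgebra.counit (R := k) (A := H)).lTensor M

/-- The right ideal `R = {r | ε(r) = 0, ∑ S⁻¹(r₂) dr₁ = 0}` of `H` determined by a right covariant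
differential algebra over `H`. -/
def rightIdeal (hS : Function.Bijective (HopfAlgebra.antipode k (A := H)))
    (Θ : DiffAlg.{u, vH, w} k H) : Submodule k H :=
  LinearMap.ker (Coalgebra.counit (R := k) (A := H)) ⊓
  LinearMap.ker (LinearMap.mul' k Θ.Form ∘ₗ
    TensorProduct.map
      (Θ.incl.toLinearMap ∘ₗ (LinearEquiv.ofBijective (HopfAlgebra.antipode k) hS).symm.toLinearMap)
      (Θ.d ∘ₗ Θ.incl.toLinearMap) ∘ₗ
    (TensorProduct.comm k H H).toLinearMap ∘ₗ Coalgebra.comul)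

/-- `Ad`-invariance of `R`, i.e. `∑ r₂ ⊗ S(r₁) r₃ ∈ R ⊗ H` for all `r ∈ R`. -/
def IsAdInvariant (R : Submodule k H) : Prop :=
  ∀ r ∈ R, ad (k := k) r ∈ LinearMap.range (R.subtype.rTensor H)

end Hopf

/-! ### Locally trivial quantum principal fibre bundles -/

/-- A locally trivial quantum principal fibre bundle with total space algebra `P`, base algebra `B`
and structure Hopf algebra `H`. The covering of `B` is given by the quotient maps `π i : B → Bi i`,
its ideals are the kernels of these. -/
structure Bundle (k : Type u) (H : Type vH) (B : Type vB) (P : Type vP) {I : Type vI}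
    (Bi : I → Type vL) [Field k] [Ring H] [HopfAlgebra k H] [Ring B] [Algebra k B]
    [Ring P] [Algebra k P] [∀ i, Ring (Bi i)] [∀ i, Algebra k (Bi i)] where
  coact : P →ₐ[k] P ⊗[k] H
  coact_coassoc : ∀ p, TensorProduct.assoc k P H H (coact.toLinearMap.rTensor H (coact p)) =
    (Coalgebra.comul (R := k) (A := H)).lTensor P (coact p)
  coact_counit : ∀ p, idEps (k := k) P (coact p) = p
  π : ∀ i, B →ₐ[k] Bi i
  π_covering : IsCompleteCovering π
  ι : B →ₐ[k] P
  ι_injective : Function.Injective ι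
  χ : ∀ i, P →ₐ[k] Bi i ⊗[k] H
  χ_covering : IsCompleteCovering χ
  χ_coact : ∀ i p, (χ i).toLinearMap.rTensor H (coact p) = freeCoact (Bi i) (χ i p)
  χ_ι : ∀ i b, χ i (ι b) = π i b ⊗ₜ 1

section Bundle

variable {k : Type u} {H : Type vH} {B : Type vB} {P : Type vP} {I : Type vI} {Bi : I → Type vL}
  [Field k] [Ring H] [HopfAlgebra k H] [Ring B] [Algebra k B]
  [Ring P] [Algebra k P] [∀ i, Ring (Bi i)] [∀ i, Algebra k (Bi i)]

/-- A differential structure on the bundle: differential algebras over the `Bi i`, a right covariant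
differential algebra over `H`, and the differential algebra over `P` for which all `χ i` are
differentiable (with extensions `χΓ i` to forms) and the kernels of the `χΓ i` intersect in zero. -/
structure DiffStructure (E : Bundle k H B P Bi) where
  ΓB : ∀ i, DiffAlg.{u, vL, w₁} k (Bi i)
  ΓH : DiffAlg.{u, vH, w₂} k H
  coactH : ΓH.Form →ₐ[k] ΓH.Form ⊗[k] H
  coactH_incl : ∀ h, coactH (ΓH.incl h) =
    ΓH.incl.toLinearMap.rTensor H (Coalgebra.comul (R := k) h)
  coactH_d : ∀ x, coactH (ΓH.d x) = ΓH.d.rTensor H (coactH x)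
  ΓP : DiffAlg.{u, vP, w₃} k P
  χΓ : ∀ i, ΓP.Form →ₐ[k] (ΓB i).Tensor ΓH
  χΓ_incl : ∀ i p, χΓ i (ΓP.incl p) = (ΓB i).tensorIncl ΓH (E.χ i p)
  χΓ_d : ∀ i x, χΓ i (ΓP.d x) = (ΓB i).tensorD ΓH (χΓ i x)
  iInf_ker : ∀ x, (∀ i, χΓ i x = 0) → x = 0

/-! ### Gauge transformations -/

variable (E : Bundle k H B P Bi)

/-- The group of left gauge transformations. An element is a pair `(α, (αᵢ))` of a left
`ι(B)`-module automorphism `α` of `P` and left gauge transformations `αᵢ` of the trivial bundles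
`Bi i ⊗ H` with `χᵢ ∘ α = αᵢ ∘ χᵢ`; the `αᵢ` are determined by `α`. -/
def leftGauge : Subgroup ((P ≃ₗ[k] P) × ∀ i, (Bi i ⊗[k] H) ≃ₗ[k] (Bi i ⊗[k] H)) where
  carrier := {α | (∀ b p, α.1 (E.ι b * p) = E.ι b * α.1 p) ∧
    (∀ i b x, α.2 i ((b ⊗ₜ 1) * x) = (b ⊗ₜ 1) * α.2 i x) ∧
    (∀ i x, (α.2 i).toLinearMap.rTensor H (freeCoact (Bi i) x) = freeCoact (Bi i) (α.2 i x)) ∧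
    (∀ i b, α.2 i (b ⊗ₜ 1) = b ⊗ₜ 1) ∧
    ∀ i p, E.χ i (α.1 p) = α.2 i (E.χ i p)}
  one_mem' := by
    refine ⟨fun _ _ => rfl, fun _ _ _ => rfl, fun i x => ?_, fun _ _ => rfl, fun _ _ => rfl⟩
    exact LinearMap.congr_fun (LinearMap.rTensor_id H (Bi i ⊗[k] H)) _
  mul_mem' := by
    rintro α β ⟨a1, a2, a3, a4, a5⟩ ⟨b1, b2, b3, b4, b5⟩
    refine ⟨fun b p => ?_, fun i b x => ?_, fun i x => ?_, fun i b => ?_, fun i p => ?_⟩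
    · change α.1 (β.1 _) = _ * α.1 (β.1 _)
      rw [b1, a1]
    · change α.2 i (β.2 i _) = _ * α.2 i (β.2 i _)
      rw [b2, a2]
    · change ((α.2 i).toLinearMap ∘ₗ (β.2 i).toLinearMap).rTensor H _ =
        freeCoact (Bi i) (α.2 i (β.2 i x))
      rw [LinearMap.rTensor_comp_apply, b3, a3]
    · change α.2 i (β.2 i _) = _
      rw [b4, a4]
    · change E.χ i (α.1 (β.1 _)) = α.2 i (β.2 i _)
      rw [a5, b5]
  inv_mem' := by
    rintro α ⟨a1, a2, a3, a4, a5⟩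
    refine ⟨fun b p => ?_, fun i b x => ?_, fun i x => ?_, fun i b => ?_, fun i p => ?_⟩
    · change α.1.symm _ = _ * α.1.symm _
      rw [LinearEquiv.symm_apply_eq, a1, LinearEquiv.apply_symm_apply]
    · change (α.2 i).symm _ = _ * (α.2 i).symm _
      rw [LinearEquiv.symm_apply_eq, a2, LinearEquiv.apply_symm_apply]
    · change (α.2 i).symm.toLinearMap.rTensor H _ = freeCoact (Bi i) ((α.2 i).symm x)
      conv_lhs => rw [← (α.2 i).apply_symm_apply x]
      rw [← a3, ← LinearMap.rTensor_comp_apply, LinearEquiv.comp_coe,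
        LinearEquiv.self_trans_symm, LinearEquiv.refl_toLinearMap, LinearMap.rTensor_id_apply]
    · change (α.2 i).symm _ = _
      rw [LinearEquiv.symm_apply_eq, a4]
    · change E.χ i (α.1.symm _) = (α.2 i).symm _
      rw [LinearEquiv.eq_symm_apply, ← a5, LinearEquiv.apply_symm_apply]

/-- The group of right gauge transformations, cf. `leftGauge`. -/
def rightGauge : Subgroup ((P ≃ₗ[k] P) × ∀ i, (Bi i ⊗[k] H) ≃ₗ[k] (Bi i ⊗[k] H)) where
  carrier := {α | (∀ b p, α.1 (p * E.ι b) = α.1 p * E.ι b) ∧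
    (∀ i b x, α.2 i (x * (b ⊗ₜ 1)) = α.2 i x * (b ⊗ₜ 1)) ∧
    (∀ i x, (α.2 i).toLinearMap.rTensor H (freeCoact (Bi i) x) = freeCoact (Bi i) (α.2 i x)) ∧
    (∀ i b, α.2 i (b ⊗ₜ 1) = b ⊗ₜ 1) ∧
    ∀ i p, E.χ i (α.1 p) = α.2 i (E.χ i p)}
  one_mem' := by
    refine ⟨fun _ _ => rfl, fun _ _ _ => rfl, fun i x => ?_, fun _ _ => rfl, fun _ _ => rfl⟩
    exact LinearMap.congr_fun (LinearMap.rTensor_id H (Bi i ⊗[k] H)) _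
  mul_mem' := by
    rintro α β ⟨a1, a2, a3, a4, a5⟩ ⟨b1, b2, b3, b4, b5⟩
    refine ⟨fun b p => ?_, fun i b x => ?_, fun i x => ?_, fun i b => ?_, fun i p => ?_⟩
    · change α.1 (β.1 _) = α.1 (β.1 _) * _
      rw [b1, a1]
    · change α.2 i (β.2 i _) = α.2 i (β.2 i _) * _
      rw [b2, a2]
    · change ((α.2 i).toLinearMap ∘ₗ (β.2 i).toLinearMap).rTensor H _ =
        freeCoact (Bi i) (α.2 i (β.2 i x))
      rw [LinearMap.rTensor_comp_apply, b3, a3]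
    · change α.2 i (β.2 i _) = _
      rw [b4, a4]
    · change E.χ i (α.1 (β.1 _)) = α.2 i (β.2 i _)
      rw [a5, b5]
  inv_mem' := by
    rintro α ⟨a1, a2, a3, a4, a5⟩
    refine ⟨fun b p => ?_, fun i b x => ?_, fun i x => ?_, fun i b => ?_, fun i p => ?_⟩
    · change α.1.symm _ = α.1.symm _ * _
      rw [LinearEquiv.symm_apply_eq, a1, LinearEquiv.apply_symm_apply]
    · change (α.2 i).symm _ = (α.2 i).symm _ * _
      rw [LinearEquiv.symm_apply_eq, a2, LinearEquiv.apply_symm_apply]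
    · change (α.2 i).symm.toLinearMap.rTensor H _ = freeCoact (Bi i) ((α.2 i).symm x)
      conv_lhs => rw [← (α.2 i).apply_symm_apply x]
      rw [← a3, ← LinearMap.rTensor_comp_apply, LinearEquiv.comp_coe,
        LinearEquiv.self_trans_symm, LinearEquiv.refl_toLinearMap, LinearMap.rTensor_id_apply]
    · change (α.2 i).symm _ = _
      rw [LinearEquiv.symm_apply_eq, a4]
    · change E.χ i (α.1.symm _) = (α.2 i).symm _
      rw [LinearEquiv.eq_symm_apply, ← a5, LinearEquiv.apply_symm_apply]

variable {E}

/-- The group of pairs `(α, (αᵢ))` as above such that `α` is an algebra automorphism and is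
differentiable with respect to the differential structure, i.e. `α` with respect to `Γ(P)` and each
`αᵢ` with respect to `Γ(Bᵢ) ⊗̂ Γ(H)`. -/
def diffAut (S : DiffStructure E) :
    Subgroup ((P ≃ₗ[k] P) × ∀ i, (Bi i ⊗[k] H) ≃ₗ[k] (Bi i ⊗[k] H)) where
  carrier := {α | (∀ p q, α.1 (p * q) = α.1 p * α.1 q) ∧
    IsDifferentiableIso S.ΓP.incl.toLinearMap S.ΓP.d α.1 ∧
    ∀ i, IsDifferentiableIso ((S.ΓB i).tensorIncl S.ΓH) ((S.ΓB i).tensorD S.ΓH) (α.2 i)}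
  one_mem' := ⟨fun _ _ => rfl, ⟨AlgEquiv.refl, fun _ => rfl, fun _ => rfl⟩,
    fun _ => ⟨AlgEquiv.refl, fun _ => rfl, fun _ => rfl⟩⟩
  mul_mem' := by
    rintro α β ⟨a1, ⟨Φ, a2, a3⟩, a4⟩ ⟨b1, ⟨Ψ, b2, b3⟩, b4⟩
    refine ⟨fun p q => ?_, ⟨Ψ.trans Φ, fun a => ?_, fun x => ?_⟩, fun i => ?_⟩
    · change α.1 (β.1 _) = α.1 (β.1 _) * α.1 (β.1 _)
      rw [b1, a1]
    · change Φ (Ψ _) = S.ΓP.incl.toLinearMap (α.1 (β.1 a))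
      rw [b2, a2]
    · change Φ (Ψ _) = S.ΓP.d (Φ (Ψ x))
      rw [b3, a3]
    · obtain ⟨Φ, a2, a3⟩ := a4 i
      obtain ⟨Ψ, b2, b3⟩ := b4 i
      refine ⟨Ψ.trans Φ, fun a => ?_, fun x => ?_⟩
      · change Φ (Ψ _) = (S.ΓB i).tensorIncl S.ΓH (α.2 i (β.2 i a))
        rw [b2, a2]
      · change Φ (Ψ _) = (S.ΓB i).tensorD S.ΓH (Φ (Ψ x))
        rw [b3, a3]
  inv_mem' := by
    rintro α ⟨a1, ⟨Φ, a2, a3⟩, a4⟩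
    refine ⟨fun p q => ?_, ⟨Φ.symm, fun a => ?_, fun x => ?_⟩, fun i => ?_⟩
    · change α.1.symm _ = α.1.symm _ * α.1.symm _
      rw [LinearEquiv.symm_apply_eq, a1, LinearEquiv.apply_symm_apply,
        LinearEquiv.apply_symm_apply]
    · change Φ.symm _ = S.ΓP.incl.toLinearMap (α.1.symm a)
      rw [AlgEquiv.symm_apply_eq, a2, LinearEquiv.apply_symm_apply]
    · rw [AlgEquiv.symm_apply_eq, a3, AlgEquiv.apply_symm_apply]
    · obtain ⟨Φ, a2, a3⟩ := a4 i
      refine ⟨Φ.symm, fun a => ?_, fun x => ?_⟩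
      · change Φ.symm _ = (S.ΓB i).tensorIncl S.ΓH ((α.2 i).symm a)
        rw [AlgEquiv.symm_apply_eq, a2, LinearEquiv.apply_symm_apply]
      · rw [AlgEquiv.symm_apply_eq, a3, AlgEquiv.apply_symm_apply]

/-- The group of left gauge transformations that are differentiable algebra isomorphisms. -/
def leftQ (S : DiffStructure E) := leftGauge E ⊓ diffAut S

/-- The group of right gauge transformations that are differentiable algebra isomorphisms. -/
def rightQ (S : DiffStructure E) := rightGauge E ⊓ diffAut S

/-- The map `τ(h) = (id ⊗ ε)(α(1 ⊗ h))` of a gauge transformation of a trivial bundle `A ⊗ H`. -/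
def tau {A : Type v} [Ring A] [Algebra k A] (α : (A ⊗[k] H) ≃ₗ[k] (A ⊗[k] H)) : H →ₗ[k] A :=
  idEps A ∘ₗ α.toLinearMap ∘ₗ TensorProduct.mk k A H 1

/-- The linear map `γ ⊗ h ↦ (s(γ) ⊗ 1) f(h)` on `F ⊗ H`. -/
def leftExt {F : Type w} [Ring F] [Algebra k F] (s : F →ₗ[k] F) (f : H →ₗ[k] F ⊗[k] H) :
    F ⊗[k] H →ₗ[k] F ⊗[k] H :=
  LinearMap.mul' k (F ⊗[k] H) ∘ₗ
    TensorProduct.map ((TensorProduct.mk k F H).flip 1 ∘ₗ s) f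

/-- The linear map `γ ⊗ h ↦ f(h) (γ ⊗ 1)` on `F ⊗ H`. -/
def rightExt {F : Type w} [Ring F] [Algebra k F] (f : H →ₗ[k] F ⊗[k] H) :
    F ⊗[k] H →ₗ[k] F ⊗[k] H :=
  LinearMap.mul' k (F ⊗[k] H) ∘ₗ
    TensorProduct.map f ((TensorProduct.mk k F H).flip 1) ∘ₗ (TensorProduct.comm k F H).toLinearMap

namespace DiffStructure

variable (S : DiffStructure E)

/-! ### Horizontal forms -/

/-- The part of degree `n` of the covering completion `Γ_c(P)` of `Γ(P)` with respect to the kernels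
of the `χΓ i`, as a space of families in the `Γ(Bᵢ) ⊗̂ Γ(H)`. -/
abbrev completion (n : ℕ) : Submodule k (∀ i, (S.ΓB i).Tensor S.ΓH) :=
  glued S.χΓ (S.ΓP.deg n)

/-- Families of local horizontal forms as families of local forms. -/
def horInclPi : (∀ i, (S.ΓB i).Form ⊗[k] H) →ₗ[k] ∀ i, (S.ΓB i).Tensor S.ΓH :=
  LinearMap.pi fun i => (S.ΓB i).horIncl S.ΓH ∘ₗ LinearMap.proj i

/-- The horizontal forms `hor Γ_c(P)`: the elements of `Γ_c(P)` with components in the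
`Γ(Bᵢ) ⊗ H ⊆ Γ(Bᵢ) ⊗̂ Γ(H)`. -/
def horForms : Submodule k (∀ i, (S.ΓB i).Form ⊗[k] H) :=
  (glued S.χΓ ⊤).comap S.horInclPi

/-- The horizontal forms of degree `n`. -/
def horDeg (n : ℕ) : Submodule k (∀ i, (S.ΓB i).Form ⊗[k] H) :=
  (S.completion n).comap S.horInclPi

/-- The inclusion of horizontal one-forms into one-forms. -/
def horToForm : S.horDeg 1 →ₗ[k] S.completion 1 :=
  S.horInclPi.restrict fun _ h => h

/-- The differential `d : P → Γ_c¹(P)`. -/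
def dP : P →ₗ[k] S.completion 1 :=
  LinearMap.codRestrict _
    (LinearMap.pi fun i => (S.χΓ i).toLinearMap ∘ₗ S.ΓP.d ∘ₗ S.ΓP.incl.toLinearMap)
    fun p _ _ => ⟨S.ΓP.d (S.ΓP.incl p), S.ΓP.d_mem 0 _ (by
      rw [← S.ΓP.range_incl]; exact ⟨p, rfl⟩), rfl, rfl⟩

theorem incl_mem (p : P) : S.ΓP.incl p ∈ S.ΓP.deg 0 := by
  rw [← S.ΓP.range_incl]; exact ⟨p, rfl⟩

/-- Left multiplication of one-forms by `p ∈ P`. -/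
def lmul (p : P) : S.completion 1 →ₗ[k] S.completion 1 :=
  (LinearMap.mulLeft k fun i => S.χΓ i (S.ΓP.incl p)).restrict fun a ha i j => by
    obtain ⟨x, hx, h1, h2⟩ := ha i j
    refine ⟨S.ΓP.incl p * x, ?_, by simp [h1], by simp [h2]⟩
    simpa using SetLike.mul_mem_graded (S.incl_mem p) hx

/-- Right multiplication of one-forms by `p ∈ P`. -/
def rmul (p : P) : S.completion 1 →ₗ[k] S.completion 1 :=
  (LinearMap.mulRight k fun i => S.χΓ i (S.ΓP.incl p)).restrict fun a ha i j => by
    obtain ⟨x, hx, h1, h2⟩ := ha i j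
    refine ⟨x * S.ΓP.incl p, ?_, by simp [h1], by simp [h2]⟩
    simpa using SetLike.mul_mem_graded hx (S.incl_mem p)

/-- The right coaction `id ⊗ Δ` of `H` on `Γ(Bᵢ) ⊗̂ Γ(H)`. -/
def localCoact (i : I) : (S.ΓB i).Tensor S.ΓH →ₗ[k] (S.ΓB i).Tensor S.ΓH ⊗[k] H :=
  (GradedTensorProduct.of k (S.ΓB i).deg S.ΓH.deg).toLinearMap.rTensor H ∘ₗ
    (TensorProduct.assoc k _ _ _).symm.toLinearMap ∘ₗ
    S.coactH.toLinearMap.lTensor (S.ΓB i).Form ∘ₗ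
    (GradedTensorProduct.of k (S.ΓB i).deg S.ΓH.deg).symm.toLinearMap

/-! ### Connections -/

/-- The properties common to left and right connections: `hor : Γ_c¹(P) → hor Γ_c¹(P)` is a
projection onto the horizontal forms, commutes with the coaction of `H`, and respects the local
trivializations, `hor(ker χᵢ) ⊆ ker χᵢ`. In `covariant`, `t` is the image of `ω` under the coaction
`Γ_c¹(P) → Γ_c¹(P) ⊗ H`, which is given by the local coactions. -/
structure IsHorProjection (hor : S.completion 1 →ₗ[k] S.horDeg 1) : Prop where
  projection : ∀ η, hor (S.horToForm η) = η
  covariant : ∀ (ω : S.completion 1) (t : S.completion 1 ⊗[k] H),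
    (∀ i, (LinearMap.proj i ∘ₗ (S.completion 1).subtype).rTensor H t =
      S.localCoact i (ω.1 i)) →
    ∀ i, (LinearMap.proj i ∘ₗ (S.horDeg 1).subtype ∘ₗ hor).rTensor H t =
      freeCoact (S.ΓB i).Form ((hor ω).1 i)
  localized : ∀ i (ω : S.completion 1), ω.1 i = 0 → (hor ω).1 i = 0

/-- A left connection. -/
structure LeftConnection where
  hor : S.completion 1 →ₗ[k] S.horDeg 1
  isHor : S.IsHorProjection hor
  left_linear : ∀ p ω i, (hor (S.lmul p ω)).1 i = (S.ΓB i).baseIncl (E.χ i p) * (hor ω).1 i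

/-- A right connection. -/
structure RightConnection where
  hor : S.completion 1 →ₗ[k] S.horDeg 1
  isHor : S.IsHorProjection hor
  right_linear : ∀ p ω i, (hor (S.rmul p ω)).1 i = (hor ω).1 i * (S.ΓB i).baseIncl (E.χ i p)

variable {S} in
/-- A linear right inverse of the trivialization `χᵢ`. -/
theorem exists_section (i : I) :
    ∃ s : Bi i ⊗[k] H →ₗ[k] P, (E.χ i).toLinearMap ∘ₗ s = LinearMap.id :=
  (E.χ i).toLinearMap.exists_rightInverse_of_surjective
    (LinearMap.range_eq_top.2 (E.χ_covering.surjective i))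

/-- The restriction `x ↦ hor(dx)` to `Bᵢ ⊗ H` of the map `hor ∘ d`: an element `x` is represented as
`χᵢ(p)` with `p ∈ P`; the choice of `p` is irrelevant by `localHorD_χ`. -/
def localHorD (hor : S.completion 1 →ₗ[k] S.horDeg 1) (i : I) :
    Bi i ⊗[k] H →ₗ[k] (S.ΓB i).Form ⊗[k] H :=
  LinearMap.proj i ∘ₗ (S.horDeg 1).subtype ∘ₗ hor ∘ₗ S.dP ∘ₗ (exists_section (E := E) i).choose

theorem localHorD_χ {hor : S.completion 1 →ₗ[k] S.horDeg 1} (h : S.IsHorProjection hor)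
    (i : I) (p : P) : S.localHorD hor i (E.χ i p) = (hor (S.dP p)).1 i := by
  have hs : E.χ i ((exists_section (E := E) i).choose (E.χ i p)) = E.χ i p :=
    LinearMap.congr_fun (exists_section (E := E) i).choose_spec (E.χ i p)
  have h0 : (S.dP ((exists_section (E := E) i).choose (E.χ i p) - p)).1 i = 0 := by
    change S.χΓ i (S.ΓP.d (S.ΓP.incl _)) = 0
    rw [S.χΓ_d, S.χΓ_incl, map_sub, hs, sub_self, map_zero, map_zero]
  have h1 := h.localized i _ h0
  rw [map_sub, map_sub] at h1
  exact sub_eq_zero.1 h1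

/-- The connection map `Aᵢ : H → Γ¹(Bᵢ)`, `Aᵢ(h) = -(id ⊗ ε)(hor(d(1 ⊗ h)))`. -/
def connMap (hor : S.completion 1 →ₗ[k] S.horDeg 1) (i : I) : H →ₗ[k] (S.ΓB i).Form :=
  -(idEps (S.ΓB i).Form ∘ₗ S.localHorD hor i ∘ₗ TensorProduct.mk k (Bi i) H 1)

variable {S}

/-- The left covariant derivative `D = hor ∘ d`. On `Γ(Bᵢ) ⊗ H` one has
`d(γ ⊗ h) = dγ ⊗ h + (-1)ⁿ (γ ⊗ 1) d(1 ⊗ h)` for `γ` of degree `n`, and `hor`, being left linear,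
maps this to `dγ ⊗ h + (-1)ⁿ (γ ⊗ 1) hor(d(1 ⊗ h))`. -/
def LeftConnection.D (c : S.LeftConnection) :
    (∀ i, (S.ΓB i).Form ⊗[k] H) →ₗ[k] ∀ i, (S.ΓB i).Form ⊗[k] H :=
  LinearMap.pi fun i => ((S.ΓB i).d.rTensor H +
    leftExt (S.ΓB i).sgn (S.localHorD c.hor i ∘ₗ TensorProduct.mk k (Bi i) H 1)) ∘ₗ
    LinearMap.proj i

/-- The right covariant derivative `D = hor ∘ d`. On `Γ(Bᵢ) ⊗ H` one has
`d(γ ⊗ h) = dγ ⊗ h + d(1 ⊗ h) (γ ⊗ 1)` in `Γ(Bᵢ) ⊗̂ Γ(H)`, and `hor`, being right linear, maps this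
to `dγ ⊗ h + hor(d(1 ⊗ h)) (γ ⊗ 1)`. -/
def RightConnection.D (c : S.RightConnection) :
    (∀ i, (S.ΓB i).Form ⊗[k] H) →ₗ[k] ∀ i, (S.ΓB i).Form ⊗[k] H :=
  LinearMap.pi fun i => ((S.ΓB i).d.rTensor H +
    rightExt (S.localHorD c.hor i ∘ₗ TensorProduct.mk k (Bi i) H 1)) ∘ₗ LinearMap.proj i

variable (S)

/-- The action of left gauge transformations on horizontal forms, `γ ↦ ∑ γ₀ g(γ₁)`, where
`χᵢ(g(h)) = ∑ τᵢ(h₂) ⊗ S(h₁) h₃`. On `Γ(Bᵢ) ⊗ H` this is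
`γ ⊗ h ↦ ∑ γ τᵢ(h₁) ⊗ h₂ = (γ ⊗ 1) αᵢ(1 ⊗ h)`. -/
def leftAct (α : (P ≃ₗ[k] P) × ∀ i, (Bi i ⊗[k] H) ≃ₗ[k] (Bi i ⊗[k] H)) :
    (∀ i, (S.ΓB i).Form ⊗[k] H) →ₗ[k] ∀ i, (S.ΓB i).Form ⊗[k] H :=
  LinearMap.pi fun i => leftExt LinearMap.id
    ((S.ΓB i).baseIncl.toLinearMap ∘ₗ (α.2 i).toLinearMap ∘ₗ TensorProduct.mk k (Bi i) H 1) ∘ₗ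
    LinearMap.proj i

/-- The action of right gauge transformations on horizontal forms, `γ ↦ ∑ g(γ₁) γ₀`, where
`χᵢ(g(h)) = ∑ τᵢ(h₂) ⊗ h₃ S⁻¹(h₁)`. On `Γ(Bᵢ) ⊗ H` this is
`γ ⊗ h ↦ ∑ τᵢ(h₁) γ ⊗ h₂ = αᵢ(1 ⊗ h) (γ ⊗ 1)`. -/
def rightAct (α : (P ≃ₗ[k] P) × ∀ i, (Bi i ⊗[k] H) ≃ₗ[k] (Bi i ⊗[k] H)) :
    (∀ i, (S.ΓB i).Form ⊗[k] H) →ₗ[k] ∀ i, (S.ΓB i).Form ⊗[k] H :=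
  LinearMap.pi fun i => rightExt
    ((S.ΓB i).baseIncl.toLinearMap ∘ₗ (α.2 i).toLinearMap ∘ₗ TensorProduct.mk k (Bi i) H 1) ∘ₗ
    LinearMap.proj i

/-- The map `h ↦ ∑ A(h₂) τ(S(h₁) h₃) + ∑ τ⁻¹(h₁) dτ(h₂)` with `τ = τᵢ` the map of `α` and `τ⁻¹` the
map of `α⁻¹`. -/
def transformedMap (α : (P ≃ₗ[k] P) × ∀ i, (Bi i ⊗[k] H) ≃ₗ[k] (Bi i ⊗[k] H)) (i : I)
    (A : H →ₗ[k] (S.ΓB i).Form) : H →ₗ[k] (S.ΓB i).Form :=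
  LinearMap.mul' k (S.ΓB i).Form ∘ₗ
      TensorProduct.map A ((S.ΓB i).incl.toLinearMap ∘ₗ tau (α.2 i)) ∘ₗ ad +
    LinearMap.mul' k (S.ΓB i).Form ∘ₗ
      TensorProduct.map ((S.ΓB i).incl.toLinearMap ∘ₗ tau (α⁻¹.2 i))
        ((S.ΓB i).d ∘ₗ (S.ΓB i).incl.toLinearMap ∘ₗ tau (α.2 i)) ∘ₗ Coalgebra.comul

end DiffStructure

end Bundle

end QPFB

end

noncomputable section

namespace QPFB

universe u v w w₁ w₂ vH vB vP vI vL

namespace DiffAlg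

/-! ### Forms over one algebra: signs, generation, one-forms. -/

section Single

variable {k : Type u} [Field k] {A : Type v} [Ring A] [Algebra k A] (Γ : DiffAlg.{u, v, w} k A)

/-! Since `α` and the `αᵢ` extend to automorphisms of the differential algebras, conjugating `hor`
by them makes sense, and the conjugate `hor' = α ∘ hor ∘ α⁻¹` is the required connection.

Three facts make this work. The extensions commute with the `χΓ i`, because forms are generated by
`P` and `dP` (`χΓ_total`); they preserve degree one, spanned by the `p dq` (`deg_one_le_span`), so
they act on `Γ_c¹(P)`. The local extension fixes every `γ ⊗ 1`, as `αᵢ` fixes `b ⊗ 1` and `Bᵢ`,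
`dBᵢ` generate `Γ(Bᵢ)`. Hence it sends `γ ⊗ h = (γ ⊗ 1)(1 ⊗ h)` to `(γ ⊗ 1) αᵢ(1 ⊗ h)`: the
prescribed left action on horizontal forms is the restriction of an algebra automorphism
(`loc_horIncl`). Factoring `γ ⊗ h` in the other order shows the same for the right action. So the
two actions coincide, and applying `id ⊗ ε` shows that the values of `τᵢ` commute with all forms
(`tau_comm`).

Projection, colinearity, localization and linearity pass to `hor'`, and the Leibniz rule for `D`
identifies `α ∘ D ∘ α⁻¹` with its covariant derivative.

For the connection maps, write `*` for convolution. Expanding `α(hor(d α⁻¹(1 ⊗ h)))` and applying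
`id ⊗ ε` gives `A' = τ⁻¹ * A * τ - dτ⁻¹ * τ`. Differentiating `τ⁻¹ * τ = 1` turns the last term into
`τ⁻¹ * dτ`. As `τ` is an algebra map, `τ⁻¹ = τ ∘ S`, and commutation gathers the first term into `∑
A(h₂) τ(S(h₁) h₃)` (`mul_map_ad`). -/

theorem incl_mem_deg_zero (a : A) : Γ.incl a ∈ Γ.deg 0 := by
  rw [← Γ.range_incl]; exact ⟨a, rfl⟩

theorem d_one : Γ.d 1 = 0 := by
  have h := Γ.leibniz 0 1 (by simpa using Γ.incl_mem_deg_zero 1) 1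
  simpa using h

theorem sgn_of_mem {n : ℕ} {x : Γ.Form} (hx : x ∈ Γ.deg n) : Γ.sgn x = (-1 : k) ^ n • x := by
  rw [sgn, LinearMap.comp_apply, LinearEquiv.coe_coe, DirectSum.decomposeLinearEquiv_apply,
    DirectSum.decompose_of_mem Γ.deg hx, ← DirectSum.lof_eq_of k, DirectSum.toModule_lof]
  rfl

theorem sgn_incl (a : A) : Γ.sgn (Γ.incl a) = Γ.incl a := by
  simp [Γ.sgn_of_mem (Γ.incl_mem_deg_zero a)]

theorem homogeneous_induction {p : Γ.Form → Prop} (x : Γ.Form)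
    (hom : ∀ n, ∀ x ∈ Γ.deg n, p x) (add : ∀ x y, p x → p y → p (x + y)) : p x :=
  DirectSum.Decomposition.inductionOn Γ.deg (hom 0 0 (zero_mem _)) (fun x => hom _ x x.2) add x

/-- With the sign carried by the linear map `sgn`, the Leibniz rule is linear in `x` and needs no
homogeneity. -/
theorem d_mul (x y : Γ.Form) : Γ.d (x * y) = Γ.d x * y + Γ.sgn x * Γ.d y := by
  induction x using Γ.homogeneous_induction with
  | hom n x hx =>
    rw [Γ.leibniz n x hx, Γ.sgn_of_mem hx]
    rcases n.even_or_odd with h | h <;> simp [h.neg_one_pow]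
  | add x x' hx hx' => rw [add_mul, map_add, hx, hx', map_add, map_add]; noncomm_ring

theorem d_incl_mul (a : A) (x : Γ.Form) :
    Γ.d (Γ.incl a * x) = Γ.d (Γ.incl a) * x + Γ.incl a * Γ.d x := by
  rw [d_mul, sgn_incl]

theorem sgn_mul_incl (x : Γ.Form) (a : A) : Γ.sgn (x * Γ.incl a) = Γ.sgn x * Γ.incl a := by
  induction x using Γ.homogeneous_induction with
  | hom n x hx =>
    have h : x * Γ.incl a ∈ Γ.deg n := by
      simpa using SetLike.mul_mem_graded hx (Γ.incl_mem_deg_zero a)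
    rw [Γ.sgn_of_mem hx, Γ.sgn_of_mem h, smul_mul_assoc]
  | add x x' hx hx' => rw [add_mul, map_add, hx, hx', map_add, add_mul]

/-- Two algebra homomorphisms on forms which agree on `A` and `dA` are equal. -/
theorem algHom_ext {F : Type*} [Semiring F] [Algebra k F] {f g : Γ.Form →ₐ[k] F}
    (h : ∀ a, f (Γ.incl a) = g (Γ.incl a)) (hd : ∀ a, f (Γ.d (Γ.incl a)) = g (Γ.d (Γ.incl a))) :
    f = g := by
  refine AlgHom.ext_of_adjoin_eq_top Γ.generated ?_
  rintro _ (⟨a, rfl⟩ | ⟨a, rfl⟩)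
  exacts [h a, hd a]

/-- Supplies the product case when `deg_one_le_span` is proved by induction over generated elements.
-/
theorem proj_mul_one (x y : Γ.Form) :
    (DirectSum.decompose Γ.deg (x * y) 1 : Γ.Form) =
      DirectSum.decompose Γ.deg x 0 * (DirectSum.decompose Γ.deg y 1 : Γ.Form) +
        DirectSum.decompose Γ.deg x 1 * (DirectSum.decompose Γ.deg y 0 : Γ.Form) := by
  rw [DirectSum.decompose_mul, DirectSum.coe_mul_apply_eq_sum_antidiagonal]
  simp [Finset.Nat.antidiagonal_succ]

/-- One-forms are linear combinations of the forms `a db`. -/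
theorem deg_one_le_span :
    Γ.deg 1 ≤ Submodule.span k (Set.range fun p : A × A => Γ.incl p.1 * Γ.d (Γ.incl p.2)) := by
  set V := Submodule.span k (Set.range fun p : A × A => Γ.incl p.1 * Γ.d (Γ.incl p.2))
  have hV (a b : A) : Γ.incl a * Γ.d (Γ.incl b) ∈ V := Submodule.subset_span ⟨(a, b), rfl⟩
  have left (a : A) (x) (hx : x ∈ V) : Γ.incl a * x ∈ V := by
    induction hx using Submodule.span_induction with
    | mem x hx =>
      obtain ⟨⟨b, c⟩, rfl⟩ := hx
      simpa [mul_assoc] using hV (a * b) c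
    | zero => simp
    | add x y _ _ hx hy => rw [mul_add]; exact add_mem hx hy
    | smul c x _ hx => rw [mul_smul_comm]; exact V.smul_mem c hx
  -- The Leibniz rule, `b dc a = b d(ca) - bc da`, moves a right factor to the left.
  have right (a : A) (x) (hx : x ∈ V) : x * Γ.incl a ∈ V := by
    induction hx using Submodule.span_induction with
    | mem x hx =>
      obtain ⟨⟨b, c⟩, rfl⟩ := hx
      have h := Γ.d_incl_mul c (Γ.incl a)
      rw [← map_mul, ← sub_eq_iff_eq_add] at h
      simp only [mul_assoc, ← h]
      rw [mul_sub, ← mul_assoc, ← map_mul]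
      exact sub_mem (hV _ _) (hV _ _)
    | zero => simp
    | add x y _ _ hx hy => rw [add_mul]; exact add_mem hx hy
    | smul c x _ hx => rw [smul_mul_assoc]; exact V.smul_mem c hx
  have zero_part (x : Γ.Form) : ∃ a, Γ.incl a = DirectSum.decompose Γ.deg x 0 := by
    exact Γ.range_incl.ge (DirectSum.decompose Γ.deg x 0).2
  -- Elements produced by the generators need not be homogeneous, so the induction treats the
  -- degree-one component of an arbitrary form.
  have key (x : Γ.Form) : (DirectSum.decompose Γ.deg x 1 : Γ.Form) ∈ V := by
    have hx : x ∈ Algebra.adjoin k (Set.range Γ.incl ∪ Set.range fun a => Γ.d (Γ.incl a)) := by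
      rw [Γ.generated]; trivial
    induction hx using Algebra.adjoin_induction with
    | mem x hx =>
      rcases hx with ⟨a, rfl⟩ | ⟨a, rfl⟩
      · rw [DirectSum.decompose_of_mem_ne Γ.deg (Γ.incl_mem_deg_zero a) zero_ne_one]
        exact zero_mem _
      · rw [DirectSum.decompose_of_mem_same Γ.deg (Γ.d_mem 0 _ (Γ.incl_mem_deg_zero a))]
        simpa using hV 1 a
    | algebraMap r =>
      rw [← Γ.incl.commutes,
        DirectSum.decompose_of_mem_ne Γ.deg (Γ.incl_mem_deg_zero _) zero_ne_one]
      exact zero_mem _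
    | add x y _ _ hx hy => rw [DirectSum.decompose_add]; exact add_mem hx hy
    | mul x y _ _ hx hy =>
      obtain ⟨a, ha⟩ := zero_part x
      obtain ⟨b, hb⟩ := zero_part y
      rw [proj_mul_one, ← ha, ← hb]
      exact add_mem (left a _ hy) (right b _ hx)
  intro x hx
  rw [← DirectSum.decompose_of_mem_same Γ.deg hx]
  exact key x

end Single

/-! ### The skew tensor product and its horizontal part. -/

section Tensor

open GradedTensorProduct

variable {k : Type u} [Field k] {A : Type v} [Ring A] [Algebra k A]
  {A' : Type vH} [Ring A'] [Algebra k A']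
  (Γ : DiffAlg.{u, v, w₁} k A) (Θ : DiffAlg.{u, vH, w₂} k A')

theorem horIncl_tmul (γ : Γ.Form) (h : A') : Γ.horIncl Θ (γ ⊗ₜ h) = γ ᵍ⊗ₜ[k] Θ.incl h := rfl

theorem baseIncl_tmul (b : A) (h : A') : Γ.baseIncl (b ⊗ₜ[k] h) = Γ.incl b ⊗ₜ h := rfl

/-- Tensoring over a field is exact. This allows identities between horizontal forms to be checked
in `Γ ⊗̂ Θ`, where the extended automorphisms live. -/
theorem horIncl_injective : Function.Injective (Γ.horIncl Θ) := by
  refine (of k Γ.deg Θ.deg).injective.comp ?_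
  exact Module.Flat.lTensor_preserves_injective_linearMap (M := Γ.Form) Θ.incl.toLinearMap
    Θ.incl_injective

theorem baseIncl_injective : Function.Injective (Γ.baseIncl (A' := A')) :=
  Module.Flat.rTensor_preserves_injective_linearMap (M := A') Γ.incl.toLinearMap Γ.incl_injective

theorem tensorIncl_apply (u : A ⊗[k] A') : Γ.tensorIncl Θ u = Γ.horIncl Θ (Γ.baseIncl u) := rfl

theorem tensorIncl_injective : Function.Injective (Γ.tensorIncl Θ) :=
  (Γ.horIncl_injective Θ).comp Γ.baseIncl_injective

/-- The elements `γ ⊗ h` with `h` of degree zero multiply without signs from the left. -/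
theorem tmul_incl_mul_tmul (γ γ' : Γ.Form) (h : A') (θ : Θ.Form) :
    ((γ ᵍ⊗ₜ[k] Θ.incl h) * (γ' ᵍ⊗ₜ[k] θ) : Γ.Tensor Θ) = (γ * γ') ᵍ⊗ₜ[k] (Θ.incl h * θ) := by
  induction γ' using Γ.homogeneous_induction with
  | hom n x hx =>
    exact tmul_zero_coe_mul_coe_tmul Γ.deg Θ.deg γ ⟨_, Θ.incl_mem_deg_zero h⟩ ⟨x, hx⟩ θ
  | add x y hx hy =>
    simp only [tmul, TensorProduct.add_tmul, map_add, mul_add] at hx hy ⊢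
    rw [hx, hy]

/-- No signs occur because the second factors have degree zero, so the ordinary algebra `Γ ⊗ A'`
sits inside the skew one. -/
theorem horIncl_mul (x y : Γ.Form ⊗[k] A') :
    Γ.horIncl Θ (x * y) = Γ.horIncl Θ x * Γ.horIncl Θ y := by
  induction x using TensorProduct.induction_on with
  | zero => simp
  | add x x' hx hx' => rw [add_mul, map_add, map_add, add_mul, hx, hx']
  | tmul γ h =>
    induction y using TensorProduct.induction_on with
    | zero => simp
    | add x x' hx hx' => rw [mul_add, map_add, map_add, mul_add, hx, hx']
    | tmul γ' h' =>
      rw [Algebra.TensorProduct.tmul_mul_tmul, horIncl_tmul, horIncl_tmul, horIncl_tmul,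
        tmul_incl_mul_tmul, map_mul]

theorem tensorIncl_mul (x y : A ⊗[k] A') :
    Γ.tensorIncl Θ (x * y) = Γ.tensorIncl Θ x * Γ.tensorIncl Θ y := by
  rw [tensorIncl_apply, map_mul, horIncl_mul]; rfl

theorem tensorD_tmul (γ : Γ.Form) (θ : Θ.Form) :
    Γ.tensorD Θ (γ ᵍ⊗ₜ[k] θ) = Γ.d γ ᵍ⊗ₜ[k] θ + Γ.sgn γ ᵍ⊗ₜ[k] Θ.d θ := by
  change of k Γ.deg Θ.deg _ = _
  rw [← map_add]; rfl

theorem tensorD_horIncl_tmul_one (γ : Γ.Form) :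
    Γ.tensorD Θ (Γ.horIncl Θ (γ ⊗ₜ 1)) = Γ.horIncl Θ (Γ.d γ ⊗ₜ 1) := by
  rw [horIncl_tmul, tensorD_tmul, map_one, d_one, horIncl_tmul, map_one]
  simp [tmul]

/-- Exhibits `γ ↦ γ ⊗ 1` as an algebra homomorphism, to which `algHom_ext` applies. -/
theorem horIncl_tmul_one_eq (γ : Γ.Form) :
    Γ.horIncl Θ (γ ⊗ₜ 1) = includeLeft Γ.deg Θ.deg γ := by
  rw [horIncl_tmul, map_one]; rfl

end Tensor

end DiffAlg

/-! ### The free coaction and colinear maps. -/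

section Coaction

variable {k : Type u} [Field k] {H : Type vH} [Ring H] [HopfAlgebra k H]

theorem freeCoact_tmul (M : Type*) [AddCommGroup M] [Module k M] (m : M) (h : H) :
    freeCoact M (m ⊗ₜ[k] h) =
      (TensorProduct.mk k M H m).rTensor H (Coalgebra.comul (R := k) h) := by
  rw [freeCoact, LinearMap.comp_apply, LinearMap.lTensor_tmul]
  induction Coalgebra.comul (R := k) h using TensorProduct.induction_on with
  | zero => simp
  | add x y hx hy => rw [TensorProduct.tmul_add, map_add, map_add, hx, hy]
  | tmul a b => rfl

theorem freeCoact_rTensor {M N : Type*} [AddCommGroup M] [Module k M] [AddCommGroup N] [Module k N]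
    (f : M →ₗ[k] N) (x : M ⊗[k] H) :
    freeCoact N (f.rTensor H x) = (f.rTensor H).rTensor H (freeCoact M x) := by
  induction x using TensorProduct.induction_on with
  | zero => simp
  | add x y hx hy => simp only [map_add, hx, hy]
  | tmul m h =>
    rw [LinearMap.rTensor_tmul, freeCoact_tmul, freeCoact_tmul, ← LinearMap.rTensor_comp_apply]
    rfl

theorem idEps_tmul (M : Type*) [AddCommGroup M] [Module k M] (m : M) (h : H) :
    idEps M (m ⊗ₜ[k] h) = Coalgebra.counit (R := k) h • m := rfl

/-- This is the counit axiom `(ε ⊗ id) ∘ Δ = id` tensored with `M`. -/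
theorem rTensor_idEps_freeCoact (M : Type*) [AddCommGroup M] [Module k M] (x : M ⊗[k] H) :
    (idEps M).rTensor H (freeCoact M x) = x := by
  induction x using TensorProduct.induction_on with
  | zero => simp
  | add x y hx hy => simp only [map_add, hx, hy]
  | tmul m h =>
    rw [freeCoact_tmul, ← LinearMap.rTensor_comp_apply]
    have : idEps M ∘ₗ TensorProduct.mk k M H m =
        LinearMap.toSpanSingleton k M m ∘ₗ Coalgebra.counit (R := k) := by
      ext; simp [idEps_tmul]
    rw [this, LinearMap.rTensor_comp_apply, Coalgebra.rTensor_counit_comul]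
    simp

/-- An element `x` of `M ⊗ H` is determined by its image under `(id ⊗ ε) ⊗ id` after coaction; for
colinear `f : H → M ⊗ H` this gives `f(h) = ∑ (id ⊗ ε)(f(h₁)) ⊗ h₂`. -/
theorem eq_rTensor_comul_of_colinear {M : Type*} [AddCommGroup M] [Module k M]
    (f : H →ₗ[k] M ⊗[k] H)
    (hf : ∀ h, f.rTensor H (Coalgebra.comul (R := k) h) = freeCoact M (f h)) (h : H) :
    f h = (idEps M ∘ₗ f).rTensor H (Coalgebra.comul (R := k) h) := by
  rw [LinearMap.rTensor_comp_apply, hf, rTensor_idEps_freeCoact]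

end Coaction

/-! ### One-sided linear extensions from `H` to `F ⊗ H`. -/

section Extension

variable {k : Type u} {F : Type w} {H : Type vH} [Field k] [Ring F] [Algebra k F] [Ring H]
  [HopfAlgebra k H]

theorem leftExt_tmul (s : F →ₗ[k] F) (f : H →ₗ[k] F ⊗[k] H) (γ : F) (h : H) :
    leftExt s f (γ ⊗ₜ h) = (s γ ⊗ₜ 1) * f h := rfl

theorem rightExt_tmul (f : H →ₗ[k] F ⊗[k] H) (γ : F) (h : H) :
    rightExt f (γ ⊗ₜ h) = f h * (γ ⊗ₜ 1) := rfl

theorem leftExt_mul (f : H →ₗ[k] F ⊗[k] H) (γ : F) (x : F ⊗[k] H) :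
    leftExt LinearMap.id f ((γ ⊗ₜ 1) * x) = (γ ⊗ₜ 1) * leftExt LinearMap.id f x := by
  induction x using TensorProduct.induction_on with
  | zero => simp
  | add x y hx hy => simp only [mul_add, map_add, hx, hy]
  | tmul γ' h =>
    rw [Algebra.TensorProduct.tmul_mul_tmul, one_mul, leftExt_tmul, leftExt_tmul, ← mul_assoc,
      Algebra.TensorProduct.tmul_mul_tmul, one_mul]
    rfl

theorem freeCoact_tmul_one_mul (γ : F) (x : F ⊗[k] H) :
    freeCoact F ((γ ⊗ₜ 1) * x) = ((γ ⊗ₜ 1) ⊗ₜ 1) * freeCoact F x := by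
  -- Multiplication by `γ ⊗ 1` touches only the first factor, so naturality of the coaction applies.
  have (y : F ⊗[k] H) : (γ ⊗ₜ 1) * y = (LinearMap.mulLeft k γ).rTensor H y := by
    induction y using TensorProduct.induction_on with
    | zero => simp
    | add x y hx hy => simp only [mul_add, map_add, hx, hy]
    | tmul γ' h => simp
  rw [this, freeCoact_rTensor]
  induction freeCoact F x using TensorProduct.induction_on with
  | zero => simp
  | add x y hx hy => simp only [mul_add, map_add, hx, hy]
  | tmul y h => rw [LinearMap.rTensor_tmul, Algebra.TensorProduct.tmul_mul_tmul, this, one_mul]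

end Extension

/-! ### Gauge transformations with extensions, and the local coaction. -/

section Bundle

variable {k : Type u} {H : Type vH} {B : Type vB} {P : Type vP} {I : Type vI} {Bi : I → Type vL}
  [Field k] [Ring H] [HopfAlgebra k H] [Ring B] [Algebra k B]
  [Ring P] [Algebra k P] [∀ i, Ring (Bi i)] [∀ i, Algebra k (Bi i)]
  {E : Bundle k H B P Bi}

namespace DiffStructure

variable (S : DiffStructure E)

/-- A gauge transformation together with extensions to forms. -/
structure GaugeExtension (α : (P ≃ₗ[k] P) × ∀ i, (Bi i ⊗[k] H) ≃ₗ[k] (Bi i ⊗[k] H)) where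
  total : S.ΓP.Form ≃ₐ[k] S.ΓP.Form
  loc : ∀ i, (S.ΓB i).Tensor S.ΓH ≃ₐ[k] (S.ΓB i).Tensor S.ΓH
  base : ∀ i b, α.2 i (b ⊗ₜ 1) = b ⊗ₜ 1
  colinear : ∀ i x,
    (α.2 i).toLinearMap.rTensor H (freeCoact (Bi i) x) = freeCoact (Bi i) (α.2 i x)
  χ : ∀ i p, E.χ i (α.1 p) = α.2 i (E.χ i p)
  total_incl : ∀ p, total (S.ΓP.incl p) = S.ΓP.incl (α.1 p)
  total_d : ∀ x, total (S.ΓP.d x) = S.ΓP.d (total x)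
  loc_incl : ∀ i x, loc i ((S.ΓB i).tensorIncl S.ΓH x) = (S.ΓB i).tensorIncl S.ΓH (α.2 i x)
  loc_d : ∀ i x, loc i ((S.ΓB i).tensorD S.ΓH x) = (S.ΓB i).tensorD S.ΓH (loc i x)

/-- Left and right gauge transformations differ only in module linearity. That is dropped here,
since the extensions give back multiplicativity (`apply_mul`), and one argument then serves both
cases. -/
theorem nonempty_gaugeExtension {α : (P ≃ₗ[k] P) × ∀ i, (Bi i ⊗[k] H) ≃ₗ[k] (Bi i ⊗[k] H)}
    (h : α ∈ leftQ S ∨ α ∈ rightQ S) : Nonempty (S.GaugeExtension α) := by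
  have key (hb : ∀ i b, α.2 i (b ⊗ₜ 1) = b ⊗ₜ 1)
      (hc : ∀ i x, (α.2 i).toLinearMap.rTensor H (freeCoact (Bi i) x) = freeCoact (Bi i) (α.2 i x))
      (hχ : ∀ i p, E.χ i (α.1 p) = α.2 i (E.χ i p)) (hd : α ∈ diffAut S) :
      Nonempty (S.GaugeExtension α) := by
    obtain ⟨-, ⟨Φ, h1, h2⟩, h⟩ := hd
    choose Ψ h3 h4 using h
    exact ⟨⟨Φ, Ψ, hb, hc, hχ, h1, h2, h3, h4⟩⟩
  rcases h with ⟨⟨-, -, hc, hb, hχ⟩, hd⟩ | ⟨⟨-, -, hc, hb, hχ⟩, hd⟩ <;> exact key hb hc hχ hd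

/-- The local component `γ ⊗ h ↦ (γ ⊗ 1) αᵢ(1 ⊗ h)` of the action of gauge transformations. -/
abbrev localAct (α : (P ≃ₗ[k] P) × ∀ i, (Bi i ⊗[k] H) ≃ₗ[k] (Bi i ⊗[k] H)) (i : I) :
    (S.ΓB i).Form ⊗[k] H →ₗ[k] (S.ΓB i).Form ⊗[k] H :=
  leftExt LinearMap.id
    ((S.ΓB i).baseIncl.toLinearMap ∘ₗ (α.2 i).toLinearMap ∘ₗ TensorProduct.mk k (Bi i) H 1)

theorem localCoact_tmul (i : I) (γ : (S.ΓB i).Form) (θ : S.ΓH.Form) :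
    S.localCoact i (GradedTensorProduct.tmul k γ θ) =
      (GradedTensorProduct.of k (S.ΓB i).deg S.ΓH.deg ∘ₗ
        TensorProduct.mk k (S.ΓB i).Form S.ΓH.Form γ).rTensor H (S.coactH θ) := by
  change (GradedTensorProduct.of k (S.ΓB i).deg S.ΓH.deg).toLinearMap.rTensor H
    ((TensorProduct.assoc k _ _ _).symm (γ ⊗ₜ S.coactH θ)) = _
  induction S.coactH θ using TensorProduct.induction_on with
  | zero => simp
  | add x y hx hy => simp only [TensorProduct.tmul_add, map_add, hx, hy]
  | tmul a b => rfl

/-- The local coaction is multiplicative with respect to left multiplication by elements of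
`Bᵢ ⊗ H`. -/
theorem localCoact_tensorIncl_mul (i : I) (u : Bi i ⊗[k] H) (x : (S.ΓB i).Tensor S.ΓH) :
    S.localCoact i ((S.ΓB i).tensorIncl S.ΓH u * x) =
      ((S.ΓB i).tensorIncl S.ΓH).rTensor H (freeCoact (Bi i) u) * S.localCoact i x := by
  induction u using TensorProduct.induction_on with
  | zero => simp
  | add x y hx hy => simp only [map_add, add_mul, hx, hy]
  | tmul b h =>
    obtain ⟨x, rfl⟩ := (GradedTensorProduct.of k (S.ΓB i).deg S.ΓH.deg).surjective x
    induction x using TensorProduct.induction_on with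
    | zero => simp
    | add x y hx hy => simp only [map_add, mul_add, hx, hy]
    | tmul γ θ =>
      rw [DiffAlg.tensorIncl_apply, DiffAlg.baseIncl_tmul, DiffAlg.horIncl_tmul]
      have h1 := (S.ΓB i).tmul_incl_mul_tmul S.ΓH ((S.ΓB i).incl b) γ h θ
      have h2 := S.localCoact_tmul i γ θ
      have h3 := S.localCoact_tmul i ((S.ΓB i).incl b * γ) (S.ΓH.incl h * θ)
      refine (congrArg _ h1).trans (h3.trans ?_)
      refine Eq.trans ?_ (congrArg _ h2).symm
      rw [map_mul S.coactH, S.coactH_incl, freeCoact_tmul]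
      induction Coalgebra.comul (R := k) h using TensorProduct.induction_on with
      | zero => simp
      | add x y hx hy => simp only [map_add, add_mul, hx, hy]
      | tmul h h' =>
        induction S.coactH θ using TensorProduct.induction_on with
        | zero => simp
        | add x y hx hy => simp only [map_add, mul_add, hx, hy]
        | tmul θ h'' =>
          simp only [LinearMap.rTensor_tmul, Algebra.TensorProduct.tmul_mul_tmul]
          congr 1
          exact ((S.ΓB i).tmul_incl_mul_tmul S.ΓH ((S.ΓB i).incl b) γ h θ).symm

/-- On `d(Bᵢ ⊗ H)` the local coaction is the one induced by the coaction of `Bᵢ ⊗ H`. -/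
theorem localCoact_tensorD (i : I) (u : Bi i ⊗[k] H) :
    S.localCoact i ((S.ΓB i).tensorD S.ΓH ((S.ΓB i).tensorIncl S.ΓH u)) =
      ((S.ΓB i).tensorD S.ΓH ∘ₗ (S.ΓB i).tensorIncl S.ΓH).rTensor H (freeCoact (Bi i) u) := by
  induction u using TensorProduct.induction_on with
  | zero => simp
  | add x y hx hy => simp only [map_add, hx, hy]
  | tmul b h =>
    rw [DiffAlg.tensorIncl_apply, DiffAlg.baseIncl_tmul, DiffAlg.horIncl_tmul,
      DiffAlg.tensorD_tmul, DiffAlg.sgn_incl, map_add, localCoact_tmul, localCoact_tmul,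
      S.coactH_d, S.coactH_incl, freeCoact_tmul]
    simp only [← LinearMap.rTensor_comp_apply]
    rw [← LinearMap.add_apply, ← LinearMap.rTensor_add]
    congr 2
    ext h
    change _ = (S.ΓB i).tensorD S.ΓH
      (GradedTensorProduct.tmul k ((S.ΓB i).incl b) (S.ΓH.incl h))
    rw [DiffAlg.tensorD_tmul, DiffAlg.sgn_incl]
    rfl

end DiffStructure

end Bundle

/-! ### The action on forms and conjugation of connections. -/

section Bundle

variable {k : Type u} {H : Type vH} {B : Type vB} {P : Type vP} {I : Type vI} {Bi : I → Type vL}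
  [Field k] [Ring H] [HopfAlgebra k H] [Ring B] [Algebra k B]
  [Ring P] [Algebra k P] [∀ i, Ring (Bi i)] [∀ i, Algebra k (Bi i)]
  {E : Bundle k H B P Bi}

namespace DiffStructure

variable {S : DiffStructure E}

namespace GaugeExtension

variable {α : (P ≃ₗ[k] P) × ∀ i, (Bi i ⊗[k] H) ≃ₗ[k] (Bi i ⊗[k] H)}

/-- The extension of the inverse gauge transformation. -/
def symm (g : S.GaugeExtension α) : S.GaugeExtension α⁻¹ where
  total := g.total.symm
  loc i := (g.loc i).symm
  base i b := by
    change (α.2 i).symm _ = _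
    rw [LinearEquiv.symm_apply_eq, g.base]
  colinear i x := by
    change (α.2 i).symm.toLinearMap.rTensor H _ = freeCoact (Bi i) ((α.2 i).symm x)
    conv_lhs => rw [← (α.2 i).apply_symm_apply x]
    rw [← g.colinear, ← LinearMap.rTensor_comp_apply, LinearEquiv.comp_coe,
      LinearEquiv.self_trans_symm, LinearEquiv.refl_toLinearMap, LinearMap.rTensor_id_apply]
  χ i p := by
    change E.χ i (α.1.symm _) = (α.2 i).symm _
    rw [LinearEquiv.eq_symm_apply, ← g.χ, LinearEquiv.apply_symm_apply]
  total_incl p := by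
    change g.total.symm _ = S.ΓP.incl (α.1.symm p)
    rw [AlgEquiv.symm_apply_eq, g.total_incl, LinearEquiv.apply_symm_apply]
  total_d x := by rw [AlgEquiv.symm_apply_eq, g.total_d, AlgEquiv.apply_symm_apply]
  loc_incl i x := by
    change (g.loc i).symm _ = (S.ΓB i).tensorIncl S.ΓH ((α.2 i).symm x)
    rw [AlgEquiv.symm_apply_eq, g.loc_incl, LinearEquiv.apply_symm_apply]
  loc_d i x := by rw [AlgEquiv.symm_apply_eq, g.loc_d, AlgEquiv.apply_symm_apply]

theorem loc_symm (g : S.GaugeExtension α) (i : I) : g.symm.loc i = (g.loc i).symm := rfl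

/-- Both sides are algebra homomorphisms in `x`. They agree on `P` because `χᵢ ∘ α = αᵢ ∘ χᵢ`, and
on `dP` because every map involved commutes with `d`. -/
theorem χΓ_total (g : S.GaugeExtension α) (i : I) (x : S.ΓP.Form) : S.χΓ i (g.total x) = g.loc i (S.χΓ i x) := by
  have : (S.χΓ i).comp g.total.toAlgHom = (g.loc i).toAlgHom.comp (S.χΓ i) := by
    refine S.ΓP.algHom_ext (fun a => ?_) fun a => ?_
    · change S.χΓ i (g.total _) = g.loc i (S.χΓ i _)
      rw [g.total_incl, S.χΓ_incl, S.χΓ_incl, g.loc_incl, g.χ]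
    · change S.χΓ i (g.total _) = g.loc i (S.χΓ i _)
      rw [g.total_d, g.total_incl, S.χΓ_d, S.χΓ_d, S.χΓ_incl, S.χΓ_incl, g.loc_d, g.loc_incl, g.χ]
  exact DFunLike.congr_fun this x

/-- The extension is not assumed to be graded; it respects degree one because it sends `p dq` to
`α(p) dα(q)`. -/
theorem total_mem_deg_one (g : S.GaugeExtension α) {x : S.ΓP.Form} (hx : x ∈ S.ΓP.deg 1) : g.total x ∈ S.ΓP.deg 1 := by
  have h := S.ΓP.deg_one_le_span hx
  clear hx
  induction h using Submodule.span_induction with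
  | mem x hx =>
    obtain ⟨⟨p, q⟩, rfl⟩ := hx
    rw [map_mul, g.total_d, g.total_incl, g.total_incl]
    simpa using SetLike.mul_mem_graded (S.incl_mem (α.1 p))
      (S.ΓP.d_mem 0 _ (S.incl_mem (α.1 q)))
  | zero => simp
  | add x y _ _ hx hy => rw [map_add]; exact add_mem hx hy
  | smul c x _ hx => rw [map_smul]; exact Submodule.smul_mem _ c hx

theorem apply_mul (g : S.GaugeExtension α) (i : I) (x y : Bi i ⊗[k] H) : α.2 i (x * y) = α.2 i x * α.2 i y := by
  apply (S.ΓB i).tensorIncl_injective S.ΓH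
  rw [← g.loc_incl, DiffAlg.tensorIncl_mul, map_mul, g.loc_incl, g.loc_incl,
    DiffAlg.tensorIncl_mul]

/-- `αᵢ` fixes `b ⊗ 1`, hence its extension fixes `db ⊗ 1 = d(b ⊗ 1)`, and these generate. -/
theorem loc_horIncl_tmul_one (g : S.GaugeExtension α) (i : I) (γ : (S.ΓB i).Form) :
    g.loc i ((S.ΓB i).horIncl S.ΓH (γ ⊗ₜ 1)) = (S.ΓB i).horIncl S.ΓH (γ ⊗ₜ 1) := by
  have : (g.loc i).toAlgHom.comp (GradedTensorProduct.includeLeft (S.ΓB i).deg S.ΓH.deg) =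
      GradedTensorProduct.includeLeft (S.ΓB i).deg S.ΓH.deg := by
    have h0 (a : Bi i) : g.loc i ((S.ΓB i).horIncl S.ΓH ((S.ΓB i).incl a ⊗ₜ 1)) =
        (S.ΓB i).horIncl S.ΓH ((S.ΓB i).incl a ⊗ₜ 1) := by
      have h := g.loc_incl i (a ⊗ₜ 1)
      rw [g.base] at h
      exact h
    refine (S.ΓB i).algHom_ext (fun a => ?_) fun a => ?_
    · change g.loc i (GradedTensorProduct.includeLeft _ _ _) = _
      rw [← DiffAlg.horIncl_tmul_one_eq, h0]
    · change g.loc i (GradedTensorProduct.includeLeft _ _ _) = _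
      rw [← DiffAlg.horIncl_tmul_one_eq, ← DiffAlg.tensorD_horIncl_tmul_one, g.loc_d, h0]
  rw [DiffAlg.horIncl_tmul_one_eq]
  exact DFunLike.congr_fun this γ

/-- Links the explicit formula for the action with the abstract extension: factor `γ ⊗ h = (γ ⊗ 1)(1
⊗ h)`. Invertibility and multiplicativity of the action are then inherited from the automorphism. -/
theorem loc_horIncl (g : S.GaugeExtension α) (i : I) (x : (S.ΓB i).Form ⊗[k] H) :
    g.loc i ((S.ΓB i).horIncl S.ΓH x) = (S.ΓB i).horIncl S.ΓH (S.localAct α i x) := by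
  induction x using TensorProduct.induction_on with
  | zero => simp
  | add x y hx hy => simp only [map_add, hx, hy]
  | tmul γ h =>
    have h1 : γ ⊗ₜ[k] h = (γ ⊗ₜ 1) * (S.ΓB i).baseIncl (1 ⊗ₜ h) := by
      simp [DiffAlg.baseIncl_tmul]
    rw [leftExt_tmul, h1, DiffAlg.horIncl_mul, map_mul, loc_horIncl_tmul_one,
      DiffAlg.horIncl_mul, ← DiffAlg.tensorIncl_apply, g.loc_incl]
    rfl

theorem localAct_symm_apply (g : S.GaugeExtension α) (i : I) (x : (S.ΓB i).Form ⊗[k] H) :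
    S.localAct α i (S.localAct α⁻¹ i x) = x := by
  apply (S.ΓB i).horIncl_injective S.ΓH
  rw [← g.loc_horIncl, ← g.symm.loc_horIncl, loc_symm, AlgEquiv.apply_symm_apply]

theorem localAct_mul (g : S.GaugeExtension α) (i : I) (x y : (S.ΓB i).Form ⊗[k] H) :
    S.localAct α i (x * y) = S.localAct α i x * S.localAct α i y := by
  apply (S.ΓB i).horIncl_injective S.ΓH
  rw [← g.loc_horIncl, DiffAlg.horIncl_mul, map_mul, g.loc_horIncl, g.loc_horIncl,
    DiffAlg.horIncl_mul]

theorem localAct_tmul_one (g : S.GaugeExtension α) (i : I) (γ : (S.ΓB i).Form) :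
    S.localAct α i (γ ⊗ₜ 1) = γ ⊗ₜ 1 := by
  apply (S.ΓB i).horIncl_injective S.ΓH
  rw [← g.loc_horIncl, g.loc_horIncl_tmul_one]

theorem localAct_baseIncl (g : S.GaugeExtension α) (i : I) (u : Bi i ⊗[k] H) :
    S.localAct α i ((S.ΓB i).baseIncl u) = (S.ΓB i).baseIncl (α.2 i u) := by
  apply (S.ΓB i).horIncl_injective S.ΓH
  rw [← g.loc_horIncl, ← DiffAlg.tensorIncl_apply, g.loc_incl]
  rfl

/-- For differentiable algebra isomorphisms the left and right actions on horizontal forms agree. -/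
theorem rightExt_eq_localAct (g : S.GaugeExtension α) (i : I) :
    rightExt ((S.ΓB i).baseIncl.toLinearMap ∘ₗ (α.2 i).toLinearMap ∘ₗ
      TensorProduct.mk k (Bi i) H 1) = S.localAct α i := by
  refine TensorProduct.ext' fun γ h => ?_
  -- The opposite factorization, with `γ ⊗ 1` on the right, produces the right action from the same
  -- automorphism.
  have h1 : γ ⊗ₜ[k] h = (S.ΓB i).baseIncl (1 ⊗ₜ h) * (γ ⊗ₜ 1) := by
    simp [DiffAlg.baseIncl_tmul]
  rw [rightExt_tmul]
  conv_rhs => rw [h1, g.localAct_mul, g.localAct_baseIncl, g.localAct_tmul_one]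
  rfl

theorem rightAct_eq_leftAct (g : S.GaugeExtension α) : S.rightAct α = S.leftAct α := by
  unfold rightAct leftAct
  congr 1
  funext i
  rw [g.rightExt_eq_localAct]

/-- `αᵢ` is colinear and `γ ⊗ 1` is coinvariant. -/
theorem freeCoact_localAct (g : S.GaugeExtension α) (i : I) (x : (S.ΓB i).Form ⊗[k] H) :
    freeCoact (S.ΓB i).Form (S.localAct α i x) =
      (S.localAct α i).rTensor H (freeCoact (S.ΓB i).Form x) := by
  induction x using TensorProduct.induction_on with
  | zero => simp
  | add x y hx hy => simp only [map_add, hx, hy]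
  | tmul γ h =>
    have base (u : Bi i ⊗[k] H) : freeCoact (S.ΓB i).Form ((S.ΓB i).baseIncl u) =
        (S.ΓB i).baseIncl.toLinearMap.rTensor H (freeCoact (Bi i) u) :=
      freeCoact_rTensor (S.ΓB i).incl.toLinearMap u
    have h1 : freeCoact (S.ΓB i).Form (S.localAct α i (γ ⊗ₜ h)) = ((γ ⊗ₜ 1) ⊗ₜ 1) *
        (S.ΓB i).baseIncl.toLinearMap.rTensor H ((α.2 i).toLinearMap.rTensor H
          ((TensorProduct.mk k (Bi i) H 1).rTensor H (Coalgebra.comul (R := k) h))) := by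
      rw [leftExt_tmul, freeCoact_tmul_one_mul]
      change _ * freeCoact _ ((S.ΓB i).baseIncl (α.2 i (1 ⊗ₜ h))) = _
      rw [base, ← g.colinear, freeCoact_tmul]
      rfl
    rw [h1, freeCoact_tmul]
    induction Coalgebra.comul (R := k) h using TensorProduct.induction_on with
    | zero => simp
    | add x y hx hy => simp only [map_add, mul_add, hx, hy]
    | tmul a b =>
      simp only [LinearMap.rTensor_tmul, Algebra.TensorProduct.tmul_mul_tmul, one_mul]
      rfl

/-- The extensions to forms are colinear on one-forms. -/
theorem localCoact_loc (g : S.GaugeExtension α) (i : I) {x : S.ΓP.Form} (hx : x ∈ S.ΓP.deg 1) :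
    S.localCoact i (g.loc i (S.χΓ i x)) =
      (g.loc i).toLinearMap.rTensor H (S.localCoact i (S.χΓ i x)) := by
  have h := S.ΓP.deg_one_le_span hx
  clear hx
  induction h using Submodule.span_induction with
  | zero => simp
  | add x y _ _ hx hy => simp only [map_add, hx, hy]
  | smul c x _ hx => simp only [map_smul, hx]
  | mem x hx =>
    obtain ⟨⟨p, q⟩, rfl⟩ := hx
    -- The coaction of `p dq` is the product of the coactions of `p` and `dq`, so it suffices that
    -- `loc ⊗ id` is multiplicative and that `αᵢ` is colinear.
    have hloc (x y : (S.ΓB i).Tensor S.ΓH ⊗[k] H) :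
        (g.loc i).toLinearMap.rTensor H (x * y) =
          (g.loc i).toLinearMap.rTensor H x * (g.loc i).toLinearMap.rTensor H y :=
      map_mul (Algebra.TensorProduct.map (g.loc i).toAlgHom (AlgHom.id k H)) x y
    have h1 : (g.loc i).toLinearMap ∘ₗ (S.ΓB i).tensorIncl S.ΓH =
        (S.ΓB i).tensorIncl S.ΓH ∘ₗ (α.2 i).toLinearMap :=
      LinearMap.ext fun u => g.loc_incl i u
    have h2 : (g.loc i).toLinearMap ∘ₗ (S.ΓB i).tensorD S.ΓH ∘ₗ (S.ΓB i).tensorIncl S.ΓH =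
        ((S.ΓB i).tensorD S.ΓH ∘ₗ (S.ΓB i).tensorIncl S.ΓH) ∘ₗ (α.2 i).toLinearMap :=
      LinearMap.ext fun u => (g.loc_d i _).trans (congrArg _ (g.loc_incl i u))
    simp only [map_mul, S.χΓ_incl, S.χΓ_d, g.loc_d, g.loc_incl]
    rw [localCoact_tensorIncl_mul, localCoact_tensorIncl_mul, hloc, localCoact_tensorD,
      localCoact_tensorD, ← LinearMap.rTensor_comp_apply, ← LinearMap.rTensor_comp_apply, h1, h2,
      ← g.colinear, ← g.colinear]
    simp only [LinearMap.rTensor_comp_apply]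

/-- The action on one-forms. -/
def formMap (g : S.GaugeExtension α) : S.completion 1 →ₗ[k] S.completion 1 :=
  LinearMap.restrict (p := S.completion 1) (q := S.completion 1)
    (LinearMap.pi fun i => (g.loc i).toLinearMap ∘ₗ LinearMap.proj i) fun a ha i j => by
    obtain ⟨x, hx, h1, h2⟩ := ha i j
    refine ⟨g.total x, g.total_mem_deg_one hx, ?_, ?_⟩
    · rw [g.χΓ_total, h1]; rfl
    · rw [g.χΓ_total, h2]; rfl

theorem formMap_apply (g : S.GaugeExtension α) (ω : S.completion 1) (i : I) : (g.formMap ω).1 i = g.loc i (ω.1 i) := rfl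

/-- The action on horizontal one-forms. -/
def horMap (g : S.GaugeExtension α) : S.horDeg 1 →ₗ[k] S.horDeg 1 :=
  (S.leftAct α).restrict fun a ha => by
    have h := (g.formMap ⟨S.horInclPi a, ha⟩).2
    have : S.horInclPi (S.leftAct α a) = (g.formMap ⟨S.horInclPi a, ha⟩).1 :=
      funext fun i => (g.loc_horIncl i (a i)).symm
    change S.horInclPi (S.leftAct α a) ∈ S.completion 1
    rwa [this]

theorem formMap_horToForm (g : S.GaugeExtension α) (η : S.horDeg 1) :
    g.formMap (S.horToForm η) = S.horToForm (g.horMap η) :=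
  Subtype.ext <| funext fun i => g.loc_horIncl i (η.1 i)

theorem horMap_symm (g : S.GaugeExtension α) (η : S.horDeg 1) : g.horMap (g.symm.horMap η) = η :=
  Subtype.ext <| funext fun i => g.localAct_symm_apply i (η.1 i)

theorem formMap_dP (g : S.GaugeExtension α) (p : P) : g.formMap (S.dP p) = S.dP (α.1 p) := by
  refine Subtype.ext <| funext fun i => ?_
  change g.loc i (S.χΓ i (S.ΓP.d (S.ΓP.incl p))) = S.χΓ i (S.ΓP.d (S.ΓP.incl (α.1 p)))
  rw [← g.χΓ_total, g.total_d, g.total_incl]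

theorem formMap_lmul (g : S.GaugeExtension α) (p : P) (ω : S.completion 1) :
    g.formMap (S.lmul p ω) = S.lmul (α.1 p) (g.formMap ω) := by
  refine Subtype.ext <| funext fun i => ?_
  change g.loc i (S.χΓ i (S.ΓP.incl p) * ω.1 i) =
    S.χΓ i (S.ΓP.incl (α.1 p)) * g.loc i (ω.1 i)
  rw [map_mul, ← g.χΓ_total, g.total_incl]

theorem formMap_rmul (g : S.GaugeExtension α) (p : P) (ω : S.completion 1) :
    g.formMap (S.rmul p ω) = S.rmul (α.1 p) (g.formMap ω) := by
  refine Subtype.ext <| funext fun i => ?_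
  change g.loc i (ω.1 i * S.χΓ i (S.ΓP.incl p)) =
    g.loc i (ω.1 i) * S.χΓ i (S.ΓP.incl (α.1 p))
  rw [map_mul, ← g.χΓ_total, g.total_incl]

/-- The transform of a projection onto the horizontal forms. -/
def conj (g : S.GaugeExtension α) (hor : S.completion 1 →ₗ[k] S.horDeg 1) : S.completion 1 →ₗ[k] S.horDeg 1 :=
  g.horMap ∘ₗ hor ∘ₗ g.symm.formMap

theorem conj_apply (g : S.GaugeExtension α) (hor : S.completion 1 →ₗ[k] S.horDeg 1) (ω : S.completion 1) (i : I) :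
    (g.conj hor ω).1 i = S.localAct α i ((hor (g.symm.formMap ω)).1 i) := rfl

theorem isHorProjection_conj (g : S.GaugeExtension α) {hor : S.completion 1 →ₗ[k] S.horDeg 1} (h : S.IsHorProjection hor) :
    S.IsHorProjection (g.conj hor) where
  projection η := by
    change g.horMap (hor (g.symm.formMap (S.horToForm η))) = η
    rw [formMap_horToForm, h.projection, horMap_symm]
  covariant ω t ht i := by
    -- If `t` is the coaction of `ω`, then the coaction of `α⁻¹ω` is `(α⁻¹ ⊗ id)(t)`.
    have key := h.covariant (g.symm.formMap ω) (g.symm.formMap.rTensor H t) (fun j => by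
      -- Colinearity of the extension is known only on images of one-forms of `Γ(P)`; the diagonal
      -- pair `(j, j)` represents the `j`-th component that way.
      obtain ⟨x, hx, h1, -⟩ := ω.2 j j
      have hc := g.symm.localCoact_loc j hx
      rw [h1, ← ht j, ← LinearMap.rTensor_comp_apply] at hc
      rw [formMap_apply, hc, ← LinearMap.rTensor_comp_apply]
      rfl) i
    rw [conj_apply, g.freeCoact_localAct, ← key, ← LinearMap.rTensor_comp_apply,
      ← LinearMap.rTensor_comp_apply]
    rfl
  localized i ω hω := by
    rw [conj_apply, h.localized i, map_zero]
    rw [formMap_apply, hω, map_zero]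

theorem localHorD_conj (g : S.GaugeExtension α) {hor : S.completion 1 →ₗ[k] S.horDeg 1} (h : S.IsHorProjection hor) (i : I)
    (u : Bi i ⊗[k] H) :
    S.localHorD (g.conj hor) i u = S.localAct α i (S.localHorD hor i (α⁻¹.2 i u)) := by
  obtain ⟨p, rfl⟩ := E.χ_covering.surjective i u
  rw [S.localHorD_χ (g.isHorProjection_conj h), conj_apply, g.symm.formMap_dP, ← g.symm.χ,
    S.localHorD_χ h]

/-- The transform of a left connection. -/
def conjLeft (g : S.GaugeExtension α) (c : S.LeftConnection) : S.LeftConnection where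
  hor := g.conj c.hor
  isHor := g.isHorProjection_conj c.isHor
  left_linear p ω i := by
    -- Inside, `α⁻¹` turns the factor `p` into `α⁻¹(p)`; the outer action is multiplicative and
    -- restores it.
    rw [conj_apply, conj_apply, formMap_lmul, c.left_linear, g.localAct_mul, g.symm.χ,
      g.localAct_baseIncl]
    congr 2
    exact (α.2 i).apply_symm_apply _

/-- The transform of a right connection. -/
def conjRight (g : S.GaugeExtension α) (c : S.RightConnection) : S.RightConnection where
  hor := g.conj c.hor
  isHor := g.isHorProjection_conj c.isHor
  right_linear p ω i := by
    rw [conj_apply, conj_apply, formMap_rmul, c.right_linear, g.localAct_mul, g.symm.χ,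
      g.localAct_baseIncl]
    congr 2
    exact (α.2 i).apply_symm_apply _

end GaugeExtension

end DiffStructure

end Bundle

/-! ### Convolution identities. -/

section Convolution

open WithConv Coalgebra

variable {k : Type u} {F : Type w} {H : Type vH} [Field k] [Ring F] [Algebra k F] [Ring H]
  [HopfAlgebra k H]

/-- `∑ A(h₂) τ(S(h₁) h₃)` as a convolution product, for multiplicative `τ` whose values commute with
those of `A`. -/
theorem mul_map_ad (A τ : H →ₗ[k] F) (hτ : ∀ x y, τ (x * y) = τ x * τ y)
    (hA : ∀ x y, A x * τ y = τ y * A x) (h : H) :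
    LinearMap.mul' k F (TensorProduct.map A τ (ad (k := k) h)) =
      (toConv (τ ∘ₗ HopfAlgebra.antipode k) * (toConv A * toConv τ)) h := by
  rw [LinearMap.convMul_apply, ad]
  simp only [LinearMap.comp_apply]
  induction comul (R := k) h using TensorProduct.induction_on with
  | zero => simp
  | add x y hx hy => simp only [map_add, hx, hy]
  | tmul a b =>
    simp only [LinearMap.lTensor_tmul, TensorProduct.map_tmul, LinearMap.mul'_apply,
      LinearMap.convMul_def, LinearMap.comp_apply, LinearMap.id_apply]
    induction comul (R := k) b using TensorProduct.induction_on with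
    | zero => simp
    | add x y hx hy => simp only [map_add, TensorProduct.tmul_add, mul_add, hx, hy]
    | tmul b c =>
      -- Split `τ(S(a) c) = τ(S(a)) τ(c)` and move `τ(S(a))` past `A(b)`.
      simp [hτ, ← mul_assoc, hA, mul_assoc _ (A b)]

/-- A right convolution inverse of a homomorphism `τ` is `τ ∘ S`. -/
theorem eq_comp_antipode (τ τ' : H →ₗ[k] F) (hτ : ∀ x y, τ (x * y) = τ x * τ y) (h1 : τ 1 = 1)
    (h : toConv τ' * toConv τ = 1) : τ' = τ ∘ₗ HopfAlgebra.antipode k := by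
  -- Apply the algebra map `τ` to `id * S = 1`. The left inverse `τ'` and this right inverse must
  -- then coincide.
  have h2 : toConv τ * toConv (τ ∘ₗ HopfAlgebra.antipode k) = 1 := by
    have := LinearMap.algHom_comp_convMul_distrib (AlgHom.ofLinearMap τ h1 hτ)
      (toConv LinearMap.id) (toConv (HopfAlgebra.antipode k (A := H)))
    rw [LinearMap.id_mul_antipode] at this
    refine WithConv.ext (this.symm.trans (LinearMap.ext fun x => ?_))
    change τ (algebraMap k H _) = algebraMap k F _
    rw [Algebra.algebraMap_eq_smul_one, map_smul, h1, Algebra.algebraMap_eq_smul_one]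
  exact toConv_injective (left_inv_eq_right_inv h h2)

end Convolution

/-! ### Local formulas for `hor ∘ d` and the covariant derivatives. -/

section Bundle

variable {k : Type u} {H : Type vH} {B : Type vB} {P : Type vP} {I : Type vI} {Bi : I → Type vL}
  [Field k] [Ring H] [HopfAlgebra k H] [Ring B] [Algebra k B]
  [Ring P] [Algebra k P] [∀ i, Ring (Bi i)] [∀ i, Algebra k (Bi i)]
  {E : Bundle k H B P Bi}

namespace DiffStructure

variable {S : DiffStructure E}

theorem localHorD_colinear {hor : S.completion 1 →ₗ[k] S.horDeg 1} (h : S.IsHorProjection hor)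
    (i : I) (u : Bi i ⊗[k] H) :
    (S.localHorD hor i).rTensor H (freeCoact (Bi i) u) =
      freeCoact (S.ΓB i).Form (S.localHorD hor i u) := by
  obtain ⟨p, rfl⟩ := E.χ_covering.surjective i u
  -- The coaction of `dp` is `(d ⊗ id)` applied to the coaction of `p`.
  have key := h.covariant (S.dP p) (S.dP.rTensor H (E.coact p)) (fun j => by
    have h1 : (LinearMap.proj j ∘ₗ (S.completion 1).subtype) ∘ₗ S.dP =
        ((S.ΓB j).tensorD S.ΓH ∘ₗ (S.ΓB j).tensorIncl S.ΓH) ∘ₗ (E.χ j).toLinearMap :=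
      LinearMap.ext fun q => (S.χΓ_d j _).trans (congrArg _ (S.χΓ_incl j q))
    have h2 : (S.dP p).1 j =
        (S.ΓB j).tensorD S.ΓH ((S.ΓB j).tensorIncl S.ΓH (E.χ j p)) := LinearMap.congr_fun h1 p
    rw [h2, localCoact_tensorD, ← E.χ_coact, ← LinearMap.rTensor_comp_apply,
      ← LinearMap.rTensor_comp_apply, h1]) i
  have h1 : (LinearMap.proj i ∘ₗ (S.horDeg 1).subtype ∘ₗ hor) ∘ₗ S.dP =
      S.localHorD hor i ∘ₗ (E.χ i).toLinearMap :=
    LinearMap.ext fun q => (S.localHorD_χ h i q).symm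
  rw [S.localHorD_χ h, ← key, ← E.χ_coact, ← LinearMap.rTensor_comp_apply,
    ← LinearMap.rTensor_comp_apply, h1]

/-- `hor(d(1 ⊗ h)) = -∑ A(h₁) ⊗ h₂`. -/
theorem localHorD_one_tmul {hor : S.completion 1 →ₗ[k] S.horDeg 1} (h : S.IsHorProjection hor)
    (i : I) (a : H) :
    S.localHorD hor i (1 ⊗ₜ a) =
      -(S.connMap hor i).rTensor H (Coalgebra.comul (R := k) a) := by
  have key := eq_rTensor_comul_of_colinear (S.localHorD hor i ∘ₗ TensorProduct.mk k (Bi i) H 1)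
    (fun a => by
      rw [LinearMap.rTensor_comp_apply, ← freeCoact_tmul, localHorD_colinear h]; rfl) a
  rw [connMap, LinearMap.rTensor_neg, LinearMap.neg_apply, neg_neg]
  exact key

theorem dP_mul (p q : P) : S.dP (p * q) = S.rmul q (S.dP p) + S.lmul p (S.dP q) := by
  refine Subtype.ext <| funext fun i => ?_
  change S.χΓ i (S.ΓP.d (S.ΓP.incl (p * q))) = S.χΓ i (S.ΓP.d (S.ΓP.incl p)) *
    S.χΓ i (S.ΓP.incl q) + S.χΓ i (S.ΓP.incl p) * S.χΓ i (S.ΓP.d (S.ΓP.incl q))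
  rw [map_mul, DiffAlg.d_incl_mul, map_add, map_mul, map_mul]

/-- A one-form whose components are horizontal is its own horizontal part. -/
theorem hor_apply_of_eq {hor : S.completion 1 →ₗ[k] S.horDeg 1} (h : S.IsHorProjection hor)
    (ω : S.completion 1) (x : ∀ i, (S.ΓB i).Form ⊗[k] H)
    (hx : ∀ i, (S.ΓB i).horIncl S.ΓH (x i) = ω.1 i) (i : I) : (hor ω).1 i = x i := by
  have hω : S.horInclPi x = ω.1 := funext hx
  have hm : x ∈ S.horDeg 1 := by
    change S.horInclPi x ∈ S.completion 1
    rw [hω]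
    exact ω.2
  have : ω = S.horToForm ⟨x, hm⟩ := Subtype.ext hω.symm
  rw [this, h.projection]

/-- Differentials of base elements are horizontal in every component, because `d1 = 0`. -/
theorem χΓ_dP_ι (i : I) (b : B) : (S.dP (E.ι b)).1 i =
    (S.ΓB i).horIncl S.ΓH ((S.ΓB i).d ((S.ΓB i).incl (E.π i b)) ⊗ₜ 1) := by
  change S.χΓ i (S.ΓP.d (S.ΓP.incl (E.ι b))) = _
  rw [S.χΓ_d, S.χΓ_incl, E.χ_ι, ← DiffAlg.tensorD_horIncl_tmul_one]
  rfl

/-- Lift to `d(ι(b) q) = dι(b) q + ι(b) dq`: the first term is horizontal, hence fixed by `hor`, and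
left linearity handles the second. -/
theorem LeftConnection.localHorD_tmul (c : S.LeftConnection) (i : I) (b : Bi i) (h : H) :
    S.localHorD c.hor i (b ⊗ₜ h) = (S.ΓB i).d ((S.ΓB i).incl b) ⊗ₜ h +
      ((S.ΓB i).incl b ⊗ₜ 1) * S.localHorD c.hor i (1 ⊗ₜ h) := by
  obtain ⟨b, rfl⟩ := E.π_covering.surjective i b
  obtain ⟨q, hq⟩ := E.χ_covering.surjective i (1 ⊗ₜ h)
  have h1 : E.π i b ⊗ₜ[k] h = E.χ i (E.ι b * q) := by rw [map_mul, E.χ_ι, hq]; simp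
  -- `hor` acts on whole families, so `dι(b) q` must be horizontal over all indices, not just `i`;
  -- this is why `b` was lifted to `B`.
  have h2 := S.hor_apply_of_eq c.isHor (S.rmul q (S.dP (E.ι b)))
    (fun i => ((S.ΓB i).d ((S.ΓB i).incl (E.π i b)) ⊗ₜ 1) * (S.ΓB i).baseIncl (E.χ i q))
    (fun i => by
      change _ = (S.dP (E.ι b)).1 i * S.χΓ i (S.ΓP.incl q)
      rw [DiffAlg.horIncl_mul, χΓ_dP_ι, S.χΓ_incl]
      rfl) i
  rw [h1, ← hq, S.localHorD_χ c.isHor, S.localHorD_χ c.isHor, dP_mul, map_add]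
  change (c.hor _).1 i + (c.hor _).1 i = _
  rw [h2, c.left_linear, E.χ_ι, hq, DiffAlg.baseIncl_tmul, DiffAlg.baseIncl_tmul]
  simp

theorem RightConnection.localHorD_tmul (c : S.RightConnection) (i : I) (b : Bi i) (h : H) :
    S.localHorD c.hor i (b ⊗ₜ h) = (S.ΓB i).d ((S.ΓB i).incl b) ⊗ₜ h +
      S.localHorD c.hor i (1 ⊗ₜ h) * ((S.ΓB i).incl b ⊗ₜ 1) := by
  obtain ⟨b, rfl⟩ := E.π_covering.surjective i b
  obtain ⟨q, hq⟩ := E.χ_covering.surjective i (1 ⊗ₜ h)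
  -- With `ι(b)` on the right, the Leibniz term needing linearity is `dq ι(b)`.
  have h1 : E.π i b ⊗ₜ[k] h = E.χ i (q * E.ι b) := by rw [map_mul, E.χ_ι, hq]; simp
  have h2 := S.hor_apply_of_eq c.isHor (S.lmul q (S.dP (E.ι b)))
    (fun i => (S.ΓB i).baseIncl (E.χ i q) * ((S.ΓB i).d ((S.ΓB i).incl (E.π i b)) ⊗ₜ 1))
    (fun i => by
      change _ = S.χΓ i (S.ΓP.incl q) * (S.dP (E.ι b)).1 i
      rw [DiffAlg.horIncl_mul, χΓ_dP_ι, S.χΓ_incl]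
      rfl) i
  rw [h1, ← hq, S.localHorD_χ c.isHor, S.localHorD_χ c.isHor, dP_mul, map_add]
  change (c.hor _).1 i + (c.hor _).1 i = _
  rw [h2, c.right_linear, E.χ_ι, hq, DiffAlg.baseIncl_tmul, DiffAlg.baseIncl_tmul, add_comm]
  simp

theorem LeftConnection.D_apply (c : S.LeftConnection) (η : ∀ i, (S.ΓB i).Form ⊗[k] H) (i : I) :
    c.D η i = (S.ΓB i).d.rTensor H (η i) + leftExt (S.ΓB i).sgn
      (S.localHorD c.hor i ∘ₗ TensorProduct.mk k (Bi i) H 1) (η i) := rfl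

theorem RightConnection.D_apply (c : S.RightConnection) (η : ∀ i, (S.ΓB i).Form ⊗[k] H) (i : I) :
    c.D η i = (S.ΓB i).d.rTensor H (η i) + rightExt
      (S.localHorD c.hor i ∘ₗ TensorProduct.mk k (Bi i) H 1) (η i) := rfl

/-- A Leibniz rule for `D`, needed because `α⁻¹(γ ⊗ h) = (γ ⊗ 1) αᵢ⁻¹(1 ⊗ h)` has a general element
of `Bᵢ ⊗ H` as second factor. -/
theorem LeftConnection.D_mul_baseIncl (c : S.LeftConnection) (i : I) (γ : (S.ΓB i).Form)
    (u : Bi i ⊗[k] H) :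
    (S.ΓB i).d.rTensor H ((γ ⊗ₜ 1) * (S.ΓB i).baseIncl u) + leftExt (S.ΓB i).sgn
        (S.localHorD c.hor i ∘ₗ TensorProduct.mk k (Bi i) H 1) ((γ ⊗ₜ 1) * (S.ΓB i).baseIncl u) =
      ((S.ΓB i).d γ ⊗ₜ 1) * (S.ΓB i).baseIncl u +
        ((S.ΓB i).sgn γ ⊗ₜ 1) * S.localHorD c.hor i u := by
  induction u using TensorProduct.induction_on with
  | zero => simp
  | add x y hx hy =>
    simp only [map_add, mul_add]
    rw [add_add_add_comm, hx, hy, add_add_add_comm]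
  | tmul b h =>
    rw [DiffAlg.baseIncl_tmul, Algebra.TensorProduct.tmul_mul_tmul, one_mul,
      LinearMap.rTensor_tmul, leftExt_tmul, DiffAlg.d_mul, DiffAlg.sgn_mul_incl,
      c.localHorD_tmul, mul_add, ← mul_assoc]
    simp only [Algebra.TensorProduct.tmul_mul_tmul, one_mul, TensorProduct.add_tmul]
    rw [add_assoc]
    rfl

theorem RightConnection.D_baseIncl_mul (c : S.RightConnection) (i : I) (γ : (S.ΓB i).Form)
    (u : Bi i ⊗[k] H) :
    (S.ΓB i).d.rTensor H ((S.ΓB i).baseIncl u * (γ ⊗ₜ 1)) + rightExt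
        (S.localHorD c.hor i ∘ₗ TensorProduct.mk k (Bi i) H 1) ((S.ΓB i).baseIncl u * (γ ⊗ₜ 1)) =
      (S.ΓB i).baseIncl u * ((S.ΓB i).d γ ⊗ₜ 1) + S.localHorD c.hor i u * (γ ⊗ₜ 1) := by
  induction u using TensorProduct.induction_on with
  | zero => simp
  | add x y hx hy =>
    simp only [map_add, add_mul]
    rw [add_add_add_comm, hx, hy, add_add_add_comm]
  | tmul b h =>
    rw [DiffAlg.baseIncl_tmul, Algebra.TensorProduct.tmul_mul_tmul, mul_one,
      LinearMap.rTensor_tmul, rightExt_tmul, DiffAlg.d_incl_mul, c.localHorD_tmul, add_mul,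
      mul_assoc]
    simp only [Algebra.TensorProduct.tmul_mul_tmul, mul_one, TensorProduct.add_tmul]
    rw [← add_assoc]
    congr 1
    exact add_comm _ _

end DiffStructure

end Bundle

/-! ### Transformation of connection maps and of covariant derivatives. -/

section Bundle

open WithConv

variable {k : Type u} {H : Type vH} {B : Type vB} {P : Type vP} {I : Type vI} {Bi : I → Type vL}
  [Field k] [Ring H] [HopfAlgebra k H] [Ring B] [Algebra k B]
  [Ring P] [Algebra k P] [∀ i, Ring (Bi i)] [∀ i, Algebra k (Bi i)]
  {E : Bundle k H B P Bi}

/-- The counit is multiplicative, so `id ⊗ ε` is too. -/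
theorem idEps_mul {F : Type*} [Ring F] [Algebra k F] (x y : F ⊗[k] H) :
    idEps F (x * y) = idEps F x * idEps F y := by
  induction x using TensorProduct.induction_on with
  | zero => simp
  | add x x' hx hx' => simp only [add_mul, map_add, hx, hx']
  | tmul a h =>
    induction y using TensorProduct.induction_on with
    | zero => simp
    | add x x' hx hx' => simp only [mul_add, map_add, hx, hx']
    | tmul b h' => rw [Algebra.TensorProduct.tmul_mul_tmul, idEps_tmul, idEps_tmul, idEps_tmul,
      Bialgebra.counit_mul, smul_mul_smul_comm]

theorem idEps_tmul_one {F : Type*} [Ring F] [Algebra k F] (x : F) :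
    idEps F (x ⊗ₜ[k] (1 : H)) = x := by simp [idEps_tmul]

namespace DiffAlg

variable {A : Type v} [Ring A] [Algebra k A] (Γ : DiffAlg.{u, v, w} k A)

theorem idEps_baseIncl (x : A ⊗[k] H) : idEps Γ.Form (Γ.baseIncl x) = Γ.incl (idEps A x) := by
  induction x using TensorProduct.induction_on with
  | zero => simp
  | add x x' hx hx' => simp only [map_add, hx, hx']
  | tmul a h => simp [baseIncl_tmul, idEps_tmul]

/-- The differential is a derivation of the convolution product of `A`-valued maps. -/
theorem d_incl_convMul (f g : WithConv (H →ₗ[k] A)) :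
    toConv (Γ.d ∘ₗ Γ.incl.toLinearMap ∘ₗ (f * g).ofConv) =
      toConv (Γ.d ∘ₗ Γ.incl.toLinearMap ∘ₗ f.ofConv) * toConv (Γ.incl.toLinearMap ∘ₗ g.ofConv) +
      toConv (Γ.incl.toLinearMap ∘ₗ f.ofConv) *
        toConv (Γ.d ∘ₗ Γ.incl.toLinearMap ∘ₗ g.ofConv) := by
  refine WithConv.ext (LinearMap.ext fun h => ?_)
  change Γ.d (Γ.incl (LinearMap.mul' k A (TensorProduct.map f.ofConv g.ofConv
      (Coalgebra.comul (R := k) h)))) =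
    LinearMap.mul' k Γ.Form (TensorProduct.map _ _ (Coalgebra.comul (R := k) h)) +
      LinearMap.mul' k Γ.Form (TensorProduct.map _ _ (Coalgebra.comul (R := k) h))
  induction Coalgebra.comul (R := k) h using TensorProduct.induction_on with
  | zero => simp
  | add x y hx hy =>
    simp only [map_add, hx, hy]
    abel
  | tmul a b => simp [d_incl_mul]

end DiffAlg

namespace DiffStructure

variable {S : DiffStructure E}

namespace GaugeExtension

variable {α : (P ≃ₗ[k] P) × ∀ i, (Bi i ⊗[k] H) ≃ₗ[k] (Bi i ⊗[k] H)}

theorem apply_one_tmul (g : S.GaugeExtension α) (i : I) (h : H) :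
    α.2 i (1 ⊗ₜ h) = (tau (α.2 i)).rTensor H (Coalgebra.comul (R := k) h) :=
  eq_rTensor_comul_of_colinear ((α.2 i).toLinearMap ∘ₗ TensorProduct.mk k (Bi i) H 1)
    (fun a => by
      rw [LinearMap.rTensor_comp_apply, ← freeCoact_tmul, g.colinear]; rfl) h

theorem tau_apply (i : I) (h : H) : tau (α.2 i) h = idEps (Bi i) (α.2 i (1 ⊗ₜ h)) := rfl

theorem tau_one (g : S.GaugeExtension α) (i : I) : tau (α.2 i) 1 = 1 := by
  rw [tau_apply, g.base, idEps_tmul_one]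

theorem tau_mul (g : S.GaugeExtension α) (i : I) (x y : H) :
    tau (α.2 i) (x * y) = tau (α.2 i) x * tau (α.2 i) y := by
  rw [tau_apply, tau_apply, tau_apply, ← idEps_mul, ← g.apply_mul,
    Algebra.TensorProduct.tmul_mul_tmul, one_mul]

theorem idEps_localAct (i : I) (γ : (S.ΓB i).Form) (h : H) :
    idEps (S.ΓB i).Form (S.localAct α i (γ ⊗ₜ h)) = γ * (S.ΓB i).incl (tau (α.2 i) h) := by
  rw [leftExt_tmul, idEps_mul]
  change idEps _ (γ ⊗ₜ[k] 1) * idEps _ ((S.ΓB i).baseIncl (α.2 i (1 ⊗ₜ h))) = _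
  rw [idEps_tmul_one, DiffAlg.idEps_baseIncl, tau_apply]

/-- The values of `τᵢ` commute with all forms. -/
theorem tau_comm (g : S.GaugeExtension α) (i : I) (γ : (S.ΓB i).Form) (h : H) :
    γ * (S.ΓB i).incl (tau (α.2 i) h) = (S.ΓB i).incl (tau (α.2 i) h) * γ := by
  -- Both sides are `(id ⊗ ε)` of the action on `γ ⊗ h`, computed by its left and its right formula.
  rw [← idEps_localAct, ← g.rightExt_eq_localAct, rightExt_tmul, idEps_mul]
  change idEps _ ((S.ΓB i).baseIncl (α.2 i (1 ⊗ₜ h))) * idEps _ (γ ⊗ₜ[k] 1) = _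
  rw [idEps_tmul_one, DiffAlg.idEps_baseIncl, tau_apply]

/-- Apply `(id ⊗ ε) ∘ αᵢ` to `αᵢ⁻¹(1 ⊗ h) = ∑ τ⁻¹(h₁) ⊗ h₂`. -/
theorem tau_inv_mul_tau (g : S.GaugeExtension α) (i : I) :
    toConv (tau (α⁻¹.2 i)) * toConv (tau (α.2 i)) = 1 := by
  refine WithConv.ext (LinearMap.ext fun h => ?_)
  have h1 : idEps (Bi i) (α.2 i (α⁻¹.2 i (1 ⊗ₜ h))) = Coalgebra.counit (R := k) h • 1 := by
    change idEps (Bi i) (α.2 i ((α.2 i).symm (1 ⊗ₜ h))) = _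
    rw [LinearEquiv.apply_symm_apply, idEps_tmul]
  have h2 (b : Bi i) (a : H) : idEps (Bi i) (α.2 i (b ⊗ₜ a)) = b * tau (α.2 i) a := by
    have : b ⊗ₜ[k] a = (b ⊗ₜ 1) * (1 ⊗ₜ a) := by simp
    rw [this, g.apply_mul, idEps_mul, g.base, idEps_tmul_one, tau_apply]
  change LinearMap.mul' k (Bi i) (TensorProduct.map (tau (α⁻¹.2 i)) (tau (α.2 i))
    (Coalgebra.comul (R := k) h)) = algebraMap k (Bi i) (Coalgebra.counit (R := k) h)
  rw [Algebra.algebraMap_eq_smul_one, ← h1, g.symm.apply_one_tmul]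
  induction Coalgebra.comul (R := k) h using TensorProduct.induction_on with
  | zero => simp
  | add x y hx hy => simp only [map_add, hx, hy]
  | tmul a b => simp [h2]

theorem tau_inv (g : S.GaugeExtension α) (i : I) :
    tau (α⁻¹.2 i) = tau (α.2 i) ∘ₗ HopfAlgebra.antipode k :=
  eq_comp_antipode _ _ (g.tau_mul i) (g.tau_one i) (g.tau_inv_mul_tau i)

/-- The connection map of a transformed connection. -/
theorem connMap_conj (g : S.GaugeExtension α) {hor : S.completion 1 →ₗ[k] S.horDeg 1}
    (h : S.IsHorProjection hor) (i : I)
    -- The left-handed formula is demanded only for coefficients `τ⁻¹(x)`. As these commute with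
    -- forms, right connections satisfy it as well.
    (hD : ∀ x a, S.localHorD hor i (tau (α⁻¹.2 i) x ⊗ₜ a) =
      (S.ΓB i).d ((S.ΓB i).incl (tau (α⁻¹.2 i) x)) ⊗ₜ a +
        ((S.ΓB i).incl (tau (α⁻¹.2 i) x) ⊗ₜ 1) * S.localHorD hor i (1 ⊗ₜ a)) :
    S.connMap (g.conj hor) i = S.transformedMap α i (S.connMap hor i) := by
  let j := (S.ΓB i).incl.toLinearMap
  let t : WithConv (H →ₗ[k] (S.ΓB i).Form) := toConv (j ∘ₗ tau (α.2 i))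
  let t' : WithConv (H →ₗ[k] (S.ΓB i).Form) := toConv (j ∘ₗ tau (α⁻¹.2 i))
  let dt : WithConv (H →ₗ[k] (S.ΓB i).Form) := toConv ((S.ΓB i).d ∘ₗ j ∘ₗ tau (α.2 i))
  let dt' : WithConv (H →ₗ[k] (S.ΓB i).Form) := toConv ((S.ΓB i).d ∘ₗ j ∘ₗ tau (α⁻¹.2 i))
  let A : WithConv (H →ₗ[k] (S.ΓB i).Form) := toConv (S.connMap hor i)
  -- Differentiate `τ⁻¹ * τ = 1`, whose values are scalars.
  have hd : dt' * t + t' * dt = 0 := by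
    have := (S.ΓB i).d_incl_convMul (toConv (tau (α⁻¹.2 i))) (toConv (tau (α.2 i)))
    rw [g.tau_inv_mul_tau] at this
    refine this.symm.trans (WithConv.ext (LinearMap.ext fun x => ?_))
    change (S.ΓB i).d ((S.ΓB i).incl (algebraMap k (Bi i) _)) = 0
    rw [AlgHom.commutes, Algebra.algebraMap_eq_smul_one, map_smul, DiffAlg.d_one, smul_zero]
  have had (x : H) : LinearMap.mul' k (S.ΓB i).Form
      (TensorProduct.map (S.connMap hor i) (j ∘ₗ tau (α.2 i)) (ad (k := k) x)) =
        (t' * (A * t)) x := by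
    rw [mul_map_ad _ _ (fun x y => ?_) (fun x y => g.tau_comm i _ y)]
    · simp only [t', g.tau_inv]; rfl
    · simp [j, g.tau_mul]
  have hL (x : H) : idEps (S.ΓB i).Form (S.localAct α i (S.localHorD hor i (1 ⊗ₜ x))) =
      -(A * t) x := by
    rw [localHorD_one_tmul h, map_neg, map_neg, LinearMap.convMul_apply]
    congr 1
    induction Coalgebra.comul (R := k) x using TensorProduct.induction_on with
    | zero => simp
    | add x y hx hy => simp only [map_add, hx, hy]
    | tmul a b => rw [LinearMap.rTensor_tmul, idEps_localAct]; rfl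
  ext x
  -- Expand `αᵢ⁻¹(1 ⊗ x) = ∑ τ⁻¹(x₁) ⊗ x₂`, apply `hor ∘ d`, then the action and `id ⊗ ε`.
  have h1 : S.connMap (g.conj hor) i x = -(dt' * t - t' * (A * t)) x := by
    change -idEps _ (S.localHorD (g.conj hor) i (1 ⊗ₜ x)) = _
    rw [g.localHorD_conj h, g.symm.apply_one_tmul]
    congr 1
    change _ = LinearMap.mul' k _ (TensorProduct.map dt'.ofConv t.ofConv _) -
      LinearMap.mul' k _ (TensorProduct.map t'.ofConv (A * t).ofConv _)
    induction Coalgebra.comul (R := k) x using TensorProduct.induction_on with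
    | zero => simp
    | add x y hx hy =>
      simp only [map_add, hx, hy]
      abel
    | tmul a b =>
      rw [LinearMap.rTensor_tmul, hD, map_add, map_add, idEps_localAct, leftExt_mul, idEps_mul,
        idEps_tmul_one, hL, mul_neg, ← sub_eq_add_neg]
      rfl
  have h2 : S.transformedMap α i (S.connMap hor i) x = (t' * (A * t) + t' * dt) x :=
    congrArg (· + (t' * dt) x) (had x)
  rw [h1, h2, eq_neg_of_add_eq_zero_right hd]
  change -((dt' * t) x - _) = _ + -(dt' * t) x
  rw [neg_sub, sub_eq_add_neg]

theorem leftAct_apply (η : ∀ i, (S.ΓB i).Form ⊗[k] H) (i : I) :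
    S.leftAct α η i = S.localAct α i (η i) := rfl

/-- The action fixes `γ ⊗ 1` and its derivative, so `α` passes through the Leibniz rule to `αᵢ(hor(d
αᵢ⁻¹(1 ⊗ h)))`, which is `hor'(d(1 ⊗ h))`. The computation is componentwise and uses no gluing
condition on `η`. -/
theorem leftAct_D (g : S.GaugeExtension α) (c : S.LeftConnection)
    (η : ∀ i, (S.ΓB i).Form ⊗[k] H) :
    S.leftAct α (c.D (S.leftAct α⁻¹ η)) = (g.conjLeft c).D η := by
  funext i
  rw [leftAct_apply, LeftConnection.D_apply, LeftConnection.D_apply, leftAct_apply]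
  induction η i using TensorProduct.induction_on with
  | zero => simp
  | add x y hx hy =>
    simp only [map_add] at hx hy ⊢
    rw [add_add_add_comm, hx, hy, add_add_add_comm]
  | tmul γ h =>
    have h1 : S.localAct α⁻¹ i (γ ⊗ₜ h) = (γ ⊗ₜ 1) * (S.ΓB i).baseIncl (α⁻¹.2 i (1 ⊗ₜ h)) := rfl
    have h2 : α.2 i (α⁻¹.2 i (1 ⊗ₜ h)) = 1 ⊗ₜ h := (α.2 i).apply_symm_apply _
    rw [h1, c.D_mul_baseIncl, map_add, leftExt_mul, leftExt_mul, g.localAct_baseIncl, h2,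
      ← g.localHorD_conj c.isHor, LinearMap.rTensor_tmul, leftExt_tmul, DiffAlg.baseIncl_tmul]
    simp
    rfl

theorem rightAct_D (g : S.GaugeExtension α) (c : S.RightConnection)
    (η : ∀ i, (S.ΓB i).Form ⊗[k] H) :
    S.rightAct α (c.D (S.rightAct α⁻¹ η)) = (g.conjRight c).D η := by
  funext i
  rw [g.rightAct_eq_leftAct, g.symm.rightAct_eq_leftAct, leftAct_apply, RightConnection.D_apply,
    RightConnection.D_apply, leftAct_apply]
  induction η i using TensorProduct.induction_on with
  | zero => simp
  | add x y hx hy =>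
    simp only [map_add] at hx hy ⊢
    rw [add_add_add_comm, hx, hy, add_add_add_comm]
  | tmul γ h =>
    have h1 : S.localAct α⁻¹ i (γ ⊗ₜ h) = (S.ΓB i).baseIncl (α⁻¹.2 i (1 ⊗ₜ h)) * (γ ⊗ₜ 1) := by
      rw [← g.symm.rightExt_eq_localAct]; rfl
    have h2 : α.2 i (α⁻¹.2 i (1 ⊗ₜ h)) = 1 ⊗ₜ h := (α.2 i).apply_symm_apply _
    rw [h1, c.D_baseIncl_mul, map_add, g.localAct_mul, g.localAct_mul, g.localAct_baseIncl, h2,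
      g.localAct_tmul_one, g.localAct_tmul_one, ← g.localHorD_conj c.isHor,
      LinearMap.rTensor_tmul, rightExt_tmul, DiffAlg.baseIncl_tmul]
    simp
    rfl

theorem connMap_conjLeft (g : S.GaugeExtension α) (c : S.LeftConnection) (i : I) :
    S.connMap (g.conjLeft c).hor i = S.transformedMap α i (S.connMap c.hor i) :=
  g.connMap_conj c.isHor i fun _ _ => c.localHorD_tmul i _ _

theorem connMap_conjRight (g : S.GaugeExtension α) (c : S.RightConnection) (i : I) :
    S.connMap (g.conjRight c).hor i = S.transformedMap α i (S.connMap c.hor i) := by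
  refine g.connMap_conj c.isHor i fun x a => ?_
  rw [c.localHorD_tmul]
  congr 1
  induction S.localHorD c.hor i (1 ⊗ₜ a) using TensorProduct.induction_on with
  | zero => simp
  | add x y hx hy => simp only [mul_add, add_mul, hx, hy]
  | tmul γ h =>
    -- Commutation of `τ⁻¹(x)` with forms turns the right-handed formula into the left-handed one.
    rw [Algebra.TensorProduct.tmul_mul_tmul, Algebra.TensorProduct.tmul_mul_tmul, g.symm.tau_comm,
      one_mul, mul_one]

end GaugeExtension

end DiffStructure

end Bundle

end QPFB

end

theorem proposition11 {k H B P I : Type*} {Bi : I → Type*} [Field k] [Ring H] [HopfAlgebra k H]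
    [Ring B] [Algebra k B] [Ring P] [Algebra k P] [∀ i, Ring (Bi i)] [∀ i, Algebra k (Bi i)]
    [Finite I] (hS : Function.Bijective (HopfAlgebra.antipode k (A := H)))
    (E : QPFB.Bundle k H B P Bi) (S : QPFB.DiffStructure E)
    (hR : QPFB.IsAdInvariant (QPFB.rightIdeal hS S.ΓH)) :
    (∀ c : S.LeftConnection, ∀ α ∈ QPFB.leftQ S, ∃ c' : S.LeftConnection,
      (∀ η ∈ S.horForms, S.leftAct α (c.D (S.leftAct α⁻¹ η)) = c'.D η) ∧
      ∀ i, S.connMap c'.hor i = S.transformedMap α i (S.connMap c.hor i)) ∧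
    (∀ c : S.RightConnection, ∀ α ∈ QPFB.rightQ S, ∃ c' : S.RightConnection,
      (∀ η ∈ S.horForms, S.rightAct α (c.D (S.rightAct α⁻¹ η)) = c'.D η) ∧
      ∀ i, S.connMap c'.hor i = S.transformedMap α i (S.connMap c.hor i)) := by
  refine ⟨fun c α hα => ?_, fun c α hα => ?_⟩
  · obtain ⟨g⟩ := S.nonempty_gaugeExtension (Or.inl hα)
    exact ⟨g.conjLeft c, fun η _ => g.leftAct_D c η, g.connMap_conjLeft c⟩
  · obtain ⟨g⟩ := S.nonempty_gaugeExtension (Or.inr hα)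
    exact ⟨g.conjRight c, fun η _ => g.rightAct_D c η, g.connMap_conjRight c⟩
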